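/- Let $X$ be a complex manifold of dimension $n$. Write $B_\rho\subset\mathbb C^n$ for the Euclidean ball of radius $\rho$ centred at $0$, $\Delta_R\subset\mathbb C$ for the disk of radius $R$ centred at $0$, and $\Delta=\Delta_1$. Suppose that $X$ is holomorphic homogeneous regular: there are constants $0<r<R$ such that for every $p\in X$ there is a holomorphic map $f_p:X\to\mathbb C^n$ with $f_p(p)=0$ which is a biholomorphism onto its open image, and $B_r\subset f_p(X)\subset B_R$. For $p\in X$ and a holomorphic tangent vector $v\in T_pX$ define the Carathéodory and Kobayashi norms $$\|v\|_C=\sup_{f\in\mathrm{Hol}(X,\Delta)}\frac{2\,|f_*v|}{1-|f(p)|^2},\qquad \|v\|_K=\inf\Big\{\frac2R \;:\; R>0,\ f\in\mathrm{Hol}(\Delta_R,X),\ f(0)=p,\ f'(0)=v\Big\}.$$ Let $W$ be the space of holomorphic sections $\sigma$ of the canonical bundle $K_X$ with $\int_X(\sqrt{-1})^{n^2}\sigma\wedge\bar\sigma<\infty$, with inner product $(\sigma,\rho)=\int_X(\sqrt{-1})^{n^2}\sigma\wedge\bar\rho$. For an orthonormal basis $(\sigma_j)$ of $W$, with $\sigma_j=h_j\,dz_1\wedge\cdots\wedge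 dz_n$ in local coordinates, let $BE_X=\sum_j|h_j|^2$ be the Bergman kernel function and define the Bergman norm by $$\|v\|_B^2=\sum_{i,j}\frac{\partial^2\log BE_X}{\partial z_i\,\partial\bar z_j}\,v_i\bar v_j .$$ Then $W$ has an orthonormal basis, and for every orthonormal basis of $W$ the sum defining $BE_X$ converges at every point and $BE_X$ is positive and smooth in every coordinate chart of a given atlas, so that the Bergman metric is defined. Moreover the Kobayashi, Bergman and Carathéodory metrics on $X$ are mutually equivalent: for any two of them, $\|\cdot\|_1$ and $\|\cdot\|_2$, there are constants $c,C>0$ such that $$c\,\|v\|_2\le\|v\|_1\le C\,\|v\|_2\qquad\text{for all }p\in X,\ v\in T_pX .$$ -/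

import Mathlib

open scoped Manifold ContDiff ENNReal NNReal
open MeasureTheory

noncomputable section

/-- `ℂⁿ` with its Euclidean (Hermitian) norm. -/
abbrev ComplexSpace (n : ℕ) : Type := EuclideanSpace ℂ (Fin n)

section Manifold

variable (n : ℕ) (X : Type*) [TopologicalSpace X] [ChartedSpace (ComplexSpace n) X]

/-- A complex manifold `X` of dimension `n` is holomorphic homogeneous regular if there are
constants `0 < r < R` such that every point `p` admits a holomorphic map `f : X → ℂⁿ` with
`f p = 0` that is a biholomorphism onto its (open) image, and `B_r ⊆ f(X) ⊆ B_R`. -/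
def IsHolomorphicHomogeneousRegular : Prop :=
  ∃ r R : ℝ, 0 < r ∧ r < R ∧ ∀ p : X, ∃ f : X → ComplexSpace n,
    MDifferentiable 𝓘(ℂ, ComplexSpace n) 𝓘(ℂ, ComplexSpace n) f ∧
    f p = 0 ∧
    IsOpen (Set.range f) ∧
    (∃ g : ComplexSpace n → X, Function.LeftInverse g f ∧
      MDifferentiableOn 𝓘(ℂ, ComplexSpace n) 𝓘(ℂ, ComplexSpace n) g (Set.range f)) ∧
    Metric.ball 0 r ⊆ Set.range f ∧
    Set.range f ⊆ Metric.ball 0 R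

/-- Infinitesimal (Finsler pseudo-)metrics on `X`, with values in `[0, ∞]`: a length for every
holomorphic tangent vector. -/
abbrev FinslerMetric : Type _ :=
  (p : X) → TangentSpace 𝓘(ℂ, ComplexSpace n) p → ℝ≥0∞

variable {n X}

/-- Two metrics are equivalent if each is bounded above and below by positive constant multiples
of the other. -/
def FinslerMetric.Equivalent (N₁ N₂ : FinslerMetric n X) : Prop :=
  ∃ c C : ℝ≥0, 0 < c ∧ 0 < C ∧ ∀ (p : X) (v : TangentSpace 𝓘(ℂ, ComplexSpace n) p),
    (c : ℝ≥0∞) * N₂ p v ≤ N₁ p v ∧ N₁ p v ≤ (C : ℝ≥0∞) * N₂ p v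

/-! ### The Carathéodory and Kobayashi metrics -/

/-- Length of the tangent vector `w` at the point `z` of the unit disk for the Poincaré metric
`2 |dz| / (1 - |z| ^ 2)`. -/
def poincareNorm (z w : ℂ) : ℝ := 2 * ‖w‖ / (1 - ‖z‖ ^ 2)

variable (n X) in
/-- The Carathéodory metric: the supremum of the Poincaré lengths of `f_* v` over all holomorphic
maps `f` from `X` to the unit disk. -/
def caratheodoryMetric : FinslerMetric n X := fun p v =>
  ⨆ (f : X → ℂ) (_ : MDifferentiable 𝓘(ℂ, ComplexSpace n) 𝓘(ℂ) f)
    (_ : ∀ x, f x ∈ Metric.ball (0 : ℂ) 1),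
    ENNReal.ofReal (poincareNorm (f p) (mfderiv 𝓘(ℂ, ComplexSpace n) 𝓘(ℂ) f p v))

variable (n X) in
/-- The Kobayashi metric: the infimum of `2 / R` over all `R > 0` and all holomorphic maps `f` from
the disk of radius `R` to `X` with `f 0 = p` and `f' 0 = v`. -/
def kobayashiMetric : FinslerMetric n X := fun p v =>
  ⨅ (R : ℝ) (_ : 0 < R) (f : ℂ → X)
    (_ : MDifferentiableOn 𝓘(ℂ) 𝓘(ℂ, ComplexSpace n) f (Metric.ball (0 : ℂ) R))
    (_ : tangentMap 𝓘(ℂ) 𝓘(ℂ, ComplexSpace n) f ⟨0, (1 : ℂ)⟩ = ⟨p, v⟩),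
    ENNReal.ofReal (2 / R)

/-! ### The Bergman metric -/

variable (n X) in
/-- (Not necessarily holomorphic or even continuous) sections of the canonical bundle `K_X`:
a complex-multilinear alternating `n`-form on the holomorphic tangent space at every point. -/
abbrev CanonicalSection : Type _ :=
  (x : X) → (TangentSpace 𝓘(ℂ, ComplexSpace n) x) [⋀^Fin n]→L[ℂ] ℂ

/-- The coordinate vector field `∂ / ∂z_j` of the chart at `p`, at the point with coordinates
`z`. -/
def coordVector (p : X) (z : ComplexSpace n) (j : Fin n) :
    TangentSpace 𝓘(ℂ, ComplexSpace n) ((chartAt (ComplexSpace n) p).symm z) :=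
  mfderiv 𝓘(ℂ, ComplexSpace n) 𝓘(ℂ, ComplexSpace n) (chartAt (ComplexSpace n) p).symm z
    (EuclideanSpace.single j (1 : ℂ) : ComplexSpace n)

/-- The coefficient `h` of `σ = h(z) dz_1 ∧ ⋯ ∧ dz_n` in the chart at `p`. -/
def CanonicalSection.coeff (σ : CanonicalSection n X) (p : X) (z : ComplexSpace n) : ℂ :=
  σ ((chartAt (ComplexSpace n) p).symm z) (coordVector p z)

/-- A section of `K_X` is holomorphic if its coefficient in every chart is. -/
def CanonicalSection.IsHolomorphic (σ : CanonicalSection n X) : Prop :=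
  ∀ p : X, DifferentiableOn ℂ (σ.coeff p) (chartAt (ComplexSpace n) p).target

/-- The integral over `X` of a nonnegative top-degree form, which is `d p` times Lebesgue measure
in the chart at `p`. On each chart domain the form is a measure; these measures agree on overlaps,
and their supremum is the measure on `X` obtained by gluing them. -/
def lintegralDensity (d : X → ComplexSpace n → ℝ≥0∞) : ℝ≥0∞ :=
  letI : MeasurableSpace X := borel X
  (⨆ p : X, Measure.map (chartAt (ComplexSpace n) p).symm
    ((volume.restrict (chartAt (ComplexSpace n) p).target).withDensity (d p))) Set.univ

/-- The integral over `X` of a complex top-degree form, which is `d p` times Lebesgue measure in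
the chart at `p`. -/
def integralDensity (d : X → ComplexSpace n → ℂ) : ℂ :=
  (((lintegralDensity fun p z => ENNReal.ofReal (d p z).re).toReal -
    (lintegralDensity fun p z => ENNReal.ofReal (-(d p z).re)).toReal : ℝ) : ℂ) +
  (((lintegralDensity fun p z => ENNReal.ofReal (d p z).im).toReal -
    (lintegralDensity fun p z => ENNReal.ofReal (-(d p z).im)).toReal : ℝ) : ℂ) * Complex.I

namespace CanonicalSection

/-- `‖σ‖² = ∫_X (√-1)^(n²) σ ∧ σ̄`, in `[0, ∞]`. In coordinates `z = x + √-1 y` one has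
`(√-1)^(n²) dz_1 ∧ ⋯ ∧ dz_n ∧ dz̄_1 ∧ ⋯ ∧ dz̄_n = 2^n dx_1 dy_1 ⋯ dx_n dy_n`. -/
def normSq (σ : CanonicalSection n X) : ℝ≥0∞ :=
  lintegralDensity fun p z => ENNReal.ofReal (2 ^ n * ‖σ.coeff p z‖ ^ 2)

/-- `(σ, ρ) = ∫_X (√-1)^(n²) σ ∧ ρ̄`. -/
def innerProduct (σ ρ : CanonicalSection n X) : ℂ :=
  integralDensity fun p z => 2 ^ n * (σ.coeff p z * (starRingEnd ℂ) (ρ.coeff p z))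

variable (n X) in
/-- The space `W` of square-integrable holomorphic sections of `K_X`. -/
def bergmanSpace : Set (CanonicalSection n X) :=
  {σ | σ.IsHolomorphic ∧ σ.normSq < ⊤}

/-- `s` is an orthonormal basis of the Hilbert space `W`: an orthonormal subset whose linear span
is dense. -/
structure IsOrthonormalBasis (s : Set (CanonicalSection n X)) : Prop where
  mem_bergmanSpace : s ⊆ bergmanSpace n X
  inner_self : ∀ σ ∈ s, innerProduct σ σ = 1
  inner_eq_zero : ∀ σ ∈ s, ∀ ρ ∈ s, σ ≠ ρ → innerProduct σ ρ = 0
  dense_span : ∀ τ ∈ bergmanSpace n X, ∀ ε : ℝ≥0∞, 0 < ε →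
    ∃ ρ ∈ Submodule.span ℂ s, normSq (τ - ρ) < ε

end CanonicalSection

/-- The Bergman kernel function in the chart at `p`, computed with the orthonormal basis `s` of
`W`: the coefficient of
`∑_{σ ∈ s} (√-1)^(n²) σ ∧ σ̄` with respect to `(√-1)^(n²) dz_1 ∧ ⋯ ∧ dz_n ∧ dz̄_1 ∧ ⋯ ∧ dz̄_n`. -/
def bergmanKernel (s : Set (CanonicalSection n X)) (p : X) (z : ComplexSpace n) : ℝ :=
  ∑' σ : s, ‖(σ : CanonicalSection n X).coeff p z‖ ^ 2

/-- The Wirtinger derivative `∂u / ∂z_j = (∂u / ∂x_j - √-1 ∂u / ∂y_j) / 2`. -/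
def wirtinger (j : Fin n) (u : ComplexSpace n → ℂ) (z : ComplexSpace n) : ℂ :=
  (fderiv ℝ u z (EuclideanSpace.single j (1 : ℂ)) -
    Complex.I * fderiv ℝ u z (EuclideanSpace.single j Complex.I)) / 2

/-- The Wirtinger derivative `∂u / ∂z̄_j = (∂u / ∂x_j + √-1 ∂u / ∂y_j) / 2`. -/
def wirtingerBar (j : Fin n) (u : ComplexSpace n → ℂ) (z : ComplexSpace n) : ℂ :=
  (fderiv ℝ u z (EuclideanSpace.single j (1 : ℂ)) +
    Complex.I * fderiv ℝ u z (EuclideanSpace.single j Complex.I)) / 2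

/-- The coefficients `B_{i j̄} = ∂² log K / ∂z_i ∂z̄_j` of the Bergman metric in the chart at `p`,
where `K` is the Bergman kernel function. -/
def bergmanCoeff (s : Set (CanonicalSection n X)) (p : X) (i j : Fin n) (z : ComplexSpace n) : ℂ :=
  wirtinger i (wirtingerBar j fun w => ((Real.log (bergmanKernel s p w) : ℝ) : ℂ)) z

/-- The Bergman metric `‖v‖² = ∑_{i,j} B_{i j̄} v_i v̄_j`, where `v_i` are the components of `v` in
the chart at `p`. -/
def bergmanMetric (s : Set (CanonicalSection n X)) : FinslerMetric n X := fun p v =>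
  let a : ComplexSpace n :=
    mfderiv 𝓘(ℂ, ComplexSpace n) 𝓘(ℂ, ComplexSpace n) (chartAt (ComplexSpace n) p) p v
  ENNReal.ofReal (Real.sqrt
    (∑ i, ∑ j, bergmanCoeff s p i j (chartAt (ComplexSpace n) p p) *
      a i * (starRingEnd ℂ) (a j)).re)

end Manifold

end

/-! For each `p` the map `f_p` is a global chart of `X` centred at `p`, so every `v` has a Euclidean
length `|b|`, where `b` is the image of `v` under the differential of `f_p` at `p`. Each of the
three norms is shown to be comparable with `|b|`, with constants depending only on `n`, `r`, `R`;
mutual equivalence follows by transitivity.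

Carathéodory and Kobayashi. The functional `⟨b, ·⟩ / (R|b|)` maps the image of `f_p` into the unit
disk and gives the lower bound `2|b|/R` for Carathéodory (`IsGlobalChart.le_caratheodoryMetric`).
The linear disk `ζ ↦ ζ b` inside `B_r` gives the upper bound `2|b|/r` for Kobayashi
(`IsGlobalChart.kobayashiMetric_le`). Schwarz–Pick puts the first norm below the second
(`caratheodoryMetric_le_kobayashiMetric`), so both norms are squeezed.

Bergman. In a global chart, evaluation of sections is a holomorphic map `ev` into the dual of `W`.
By Parseval for functionals (`Orthonormal.tsum_norm_sq_apply`), the kernel of any orthonormal basis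
is `‖ev‖²` times the squared modulus of a holomorphic Jacobian. Hence it is smooth, and the Hessian
of its logarithm is a Fubini–Study form: the squared distance from `ev'(b)` to the line `ℂ·ev`,
divided by `‖ev‖²` (`sum_wirtinger_log_norm_sq`, `levi_quotient_eq`). The Jacobian drops out.

It remains to bound four quantities at the centre. With `m(ρ)` the `L²` norm of `dz₁ ∧ ⋯ ∧ dz_n` on
`B_ρ`, the sub-mean value inequality gives `‖ev‖ ≤ 1/m(r)`, and Cauchy's estimate then bounds
`ev'(b)`. Testing on the constant coefficient `1` gives `‖ev‖ ≥ 1/m(R)`. Testing on the coefficient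
`⟨b, ·⟩`, which vanishes at the centre, keeps `ev'(b)` at distance at least `|b|/(R m(R))` from
`ℂ·ev`. Completeness of `W` is never needed, only that of its dual. -/

/-! ### Holomorphic maps between normed spaces: Cauchy estimates and smoothness. -/

section SeveralVariables

open Metric Filter Topology

variable {E : Type*} [NormedAddCommGroup E] [NormedSpace ℂ E]
  {F : Type*} [NormedAddCommGroup F] [NormedSpace ℂ F]

/-- Cauchy's estimate for the derivative of a bounded holomorphic map on a ball. -/
theorem norm_fderiv_le_of_norm_le_on_ball {f : E → F} {c : E} {R M : ℝ} (hR : 0 < R)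
    (hd : DifferentiableOn ℂ f (ball c R)) (hM : ∀ z ∈ ball c R, ‖f z‖ ≤ M) :
    ‖fderiv ℂ f c‖ ≤ 2 * M / R := by
  refine Complex.norm_fderiv_le_div_of_mapsTo_ball hd (fun z hz => ?_) hR
  rw [mem_closedBall, dist_eq_norm]
  have h1 := hM z hz
  have h2 := hM c (mem_ball_self hR)
  linarith [norm_sub_le (f z) (f c)]

/-- The first order Taylor remainder of a bounded holomorphic map is quadratically small. -/
theorem norm_sub_sub_fderiv_le_of_norm_le_on_ball {f : E → F} {c : E} {R M : ℝ} (hR : 0 < R)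
    (hd : DifferentiableOn ℂ f (ball c R)) (hM : ∀ z ∈ ball c R, ‖f z‖ ≤ M) {z : E}
    (hz : z ∈ ball c R) :
    ‖f z - f c - fderiv ℂ f c (z - c)‖ ≤ 4 * M * (‖z - c‖ / R) ^ 2 := by
  have hdc : DifferentiableAt ℂ f c := hd.differentiableAt (ball_mem_nhds c hR)
  have hM0 : 0 ≤ M := (norm_nonneg _).trans (hM c (mem_ball_self hR))
  set g : E → F := fun w => f w - fderiv ℂ f c (w - c) with hg
  have hgd : DifferentiableOn ℂ g (ball c R) :=
    hd.sub ((fderiv ℂ f c).differentiable.comp (differentiable_id.sub_const c)).differentiableOn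
  -- The constant is `2M` from `f w - f c` plus `2M` from the linear term, by Cauchy's estimate.
  have hmaps : Set.MapsTo g (ball c R) (closedBall (g c) (4 * M)) := by
    intro w hw
    have h1 := hM w hw
    have h2 := hM c (mem_ball_self hR)
    have h3 : ‖fderiv ℂ f c (w - c)‖ ≤ 2 * M / R * R := by
      refine ((fderiv ℂ f c).le_opNorm _).trans ?_
      have := norm_fderiv_le_of_norm_le_on_ball hR hd hM
      have hw' : ‖w - c‖ ≤ R := by rw [← dist_eq_norm]; exact (mem_ball.1 hw).le
      gcongr
    rw [div_mul_cancel₀ _ hR.ne'] at h3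
    rw [mem_closedBall, dist_eq_norm]
    have : g w - g c = f w - f c - fderiv ℂ f c (w - c) := by simp [hg]; abel
    rw [this]
    linarith [norm_sub_le (f w - f c) (fderiv ℂ f c (w - c)), norm_sub_le (f w) (f c)]
  -- Subtracting the linear part makes `g - g c` vanish beyond first order, so the higher-order
  -- Schwarz lemma yields the exponent `2`.
  have hlit : (fun x => g x - g c) =o[𝓝 c] fun w => ‖w - c‖ ^ 1 := by
    have := hdc.hasFDerivAt.isLittleO
    simp only [pow_one]
    refine (this.norm_right).congr_left fun x => ?_
    simp [hg]; abel
  have := Complex.dist_le_mul_div_pow_of_mapsTo_ball_of_isLittleO hgd hmaps hlit hz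
  rw [dist_eq_norm, dist_eq_norm] at this
  have h4 : g z - g c = f z - f c - fderiv ℂ f c (z - c) := by simp [hg]; abel
  rwa [h4] at this

/-- A bounded operator-valued map on a ball which is pointwise holomorphic is differentiable at the
centre for the operator norm. -/
theorem differentiableAt_clm_of_forall_apply {V : Type*} [NormedAddCommGroup V] [NormedSpace ℂ V]
    {ev : E → V →L[ℂ] F} {c : E} {R M : ℝ} (hR : 0 < R)
    (hd : ∀ x, DifferentiableOn ℂ (fun w => ev w x) (ball c R))
    (hM : ∀ w ∈ ball c R, ‖ev w‖ ≤ M) :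
    DifferentiableAt ℂ ev c := by
  have hM0 : 0 ≤ M := (norm_nonneg _).trans (hM c (mem_ball_self hR))
  have hMx : ∀ x, ∀ w ∈ ball c R, ‖ev w x‖ ≤ M * ‖x‖ := fun x w hw =>
    (ev w).le_of_opNorm_le (hM w hw) x
  have hda : ∀ x, DifferentiableAt ℂ (fun w => ev w x) c := fun x =>
    (hd x).differentiableAt (ball_mem_nhds c hR)
  -- The candidate derivative collects the derivatives of the maps `w ↦ ev w x`; Cauchy's estimate,
  -- linear in `‖x‖`, makes it bounded.
  let L : E →L[ℂ] V →L[ℂ] F := LinearMap.mkContinuous₂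
    (LinearMap.mk₂ ℂ (fun a x => fderiv ℂ (fun w => ev w x) c a)
      (fun a b x => map_add _ _ _) (fun k a x => map_smul _ _ _)
      (fun a x y => by
        simp only [map_add]
        rw [fderiv_fun_add (hda x) (hda y)]; rfl)
      (fun k a x => by
        simp only [map_smul]
        rw [fderiv_fun_const_smul (hda x)]; rfl)) (2 * M / R) (fun a x => by
        simp only [LinearMap.mk₂_apply]
        refine ((fderiv ℂ (fun w => ev w x) c).le_opNorm a).trans ?_
        have := norm_fderiv_le_of_norm_le_on_ball hR (hd x) (hMx x)
        calc _ ≤ (2 * (M * ‖x‖) / R) * ‖a‖ := by gcongr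
          _ = _ := by ring)
  refine HasFDerivAt.differentiableAt (f' := L) (HasFDerivAt.of_isLittleO ?_)
  -- The Taylor remainder is quadratic with a constant proportional to `‖x‖`, which turns pointwise
  -- estimates into one in operator norm.
  have hO : (fun w => ev w - ev c - L (w - c)) =O[𝓝 c] fun w => ‖w - c‖ ^ 2 := by
    refine Asymptotics.IsBigO.of_bound (4 * M / R ^ 2) ?_
    filter_upwards [ball_mem_nhds c hR] with w hw
    refine ContinuousLinearMap.opNorm_le_bound _ (by positivity) fun x => ?_
    have := norm_sub_sub_fderiv_le_of_norm_le_on_ball hR (hd x) (hMx x) hw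
    calc _ ≤ 4 * (M * ‖x‖) * (‖w - c‖ / R) ^ 2 := this
      _ = _ := by simp; ring
  refine hO.trans_isLittleO ?_
  have h1 : (fun w : E => ‖w - c‖ ^ 2) =o[𝓝 c] fun w => ‖w - c‖ ^ 1 := by
    have : Tendsto (fun w : E => ‖w - c‖) (𝓝 c) (𝓝 0) := by
      have : Continuous fun w : E => ‖w - c‖ := by fun_prop
      simpa using this.tendsto c
    exact (Asymptotics.isLittleO_pow_pow (𝕜 := ℝ) one_lt_two).comp_tendsto this
  simp only [pow_one] at h1
  exact h1.of_norm_right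

/-- A uniform limit of holomorphic maps on a ball is differentiable at the centre. -/
theorem differentiableAt_of_tendstoUniformlyOn_ball [CompleteSpace F] {f : ℕ → E → F} {g : E → F}
    {c : E} {R : ℝ} (hR : 0 < R) (hd : ∀ n, DifferentiableOn ℂ (f n) (ball c R))
    (hu : TendstoUniformlyOn f g atTop (ball c R)) : DifferentiableAt ℂ g c := by
  have hR2 : 0 < R / 2 := by positivity
  have hsub : ∀ z ∈ ball c (R / 2), ball z (R / 2) ⊆ ball c R := fun z hz =>
    ball_subset_ball' (by rw [mem_ball] at hz; linarith)
  have hsub' : ball c (R / 2) ⊆ ball c R := ball_subset_ball (by linarith)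
  -- On the half ball each point keeps a ball of radius `R / 2` in the domain. Cauchy's estimate
  -- with `M = ε (R / 2) / 4` gives `ε / 2 < ε`.
  have hC : UniformCauchySeqOn (fun n z => fderiv ℂ (f n) z) atTop (ball c (R / 2)) := by
    rw [Metric.uniformCauchySeqOn_iff]
    intro ε hε
    obtain ⟨N, hN⟩ := Metric.uniformCauchySeqOn_iff.1 hu.uniformCauchySeqOn (ε * (R / 2) / 4)
      (by positivity)
    refine ⟨N, fun m hm n hn z hz => ?_⟩
    have hzz := mem_ball_self (x := z) hR2
    have hdm : ∀ k, DifferentiableAt ℂ (f k) z := fun k =>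
      (hd k).differentiableAt (isOpen_ball.mem_nhds (hsub' hz))
    rw [dist_eq_norm, ← fderiv_fun_sub (hdm m) (hdm n)]
    refine (norm_fderiv_le_of_norm_le_on_ball (M := ε * (R / 2) / 4) hR2
      (((hd m).sub (hd n)).mono (hsub z hz)) fun w hw => ?_).trans_lt ?_
    · have := hN m hm n hn w (hsub z hz hw)
      rw [dist_eq_norm] at this
      exact this.le
    · field_simp; norm_num
  have hlim : ∀ z, ∃ T : E →L[ℂ] F, z ∈ ball c (R / 2) →
      Tendsto (fun n => fderiv ℂ (f n) z) atTop (𝓝 T) := by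
    intro z
    by_cases hz : z ∈ ball c (R / 2)
    · obtain ⟨T, hT⟩ := cauchySeq_tendsto_of_complete (hC.cauchySeq hz)
      exact ⟨T, fun _ => hT⟩
    · exact ⟨0, fun h => absurd h hz⟩
  choose g' hg' using hlim
  have hu' := hC.tendstoUniformlyOn_of_tendsto fun z hz => hg' z hz
  refine (hasFDerivAt_of_tendstoUniformlyOn isOpen_ball hu' (fun n z hz => ?_)
    (fun z hz => hu.tendsto_at (hsub' hz)) (mem_ball_self hR2)).differentiableAt
  exact ((hd n).differentiableAt (isOpen_ball.mem_nhds (hsub' hz))).hasFDerivAt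

/-- The directional derivatives of a bounded holomorphic map are holomorphic. -/
theorem differentiableAt_fderiv_apply_of_norm_le_on_ball [CompleteSpace F] {f : E → F} {c : E}
    {R M : ℝ} (hR : 0 < R) (hd : DifferentiableOn ℂ f (ball c R))
    (hM : ∀ z ∈ ball c R, ‖f z‖ ≤ M) (v : E) :
    DifferentiableAt ℂ (fun z => fderiv ℂ f z v) c := by
  have hR2 : 0 < R / 2 := by positivity
  have hM0 : 0 ≤ M := (norm_nonneg _).trans (hM c (mem_ball_self hR))
  -- The offset `N` makes every increment `(t n)⁻¹ • v` shorter than `R / 2`. The directional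
  -- derivative is then a uniform limit of holomorphic difference quotients.
  obtain ⟨N, hN⟩ := exists_nat_gt (‖v‖ / (R / 2))
  rw [div_lt_iff₀ hR2] at hN
  let t : ℕ → ℂ := fun n => ((N + n + 1 : ℕ) : ℂ)
  have htn : ∀ n, ‖t n‖ = (N + n + 1 : ℕ) := fun n => by simp only [t]; exact Complex.norm_natCast _
  have ht0 : ∀ n, t n ≠ 0 := fun n => by
    rw [← norm_pos_iff, htn]; positivity
  have htv : ∀ n, ‖(t n)⁻¹ • v‖ < R / 2 := fun n => by
    rw [norm_smul, norm_inv, inv_mul_lt_iff₀ (norm_pos_iff.2 (ht0 n)), htn]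
    refine hN.trans_le ?_
    gcongr
    omega
  have hsub : ∀ z ∈ ball c (R / 2), ball z (R / 2) ⊆ ball c R := fun z hz =>
    ball_subset_ball' (by rw [mem_ball] at hz; linarith)
  have hadd : ∀ n, ∀ z ∈ ball c (R / 2), z + (t n)⁻¹ • v ∈ ball z (R / 2) := fun n z hz => by
    rw [mem_ball, dist_eq_norm, add_sub_cancel_left]; exact htv n
  refine differentiableAt_of_tendstoUniformlyOn_ball (R := R / 2)
    (f := fun n z => t n • (f (z + (t n)⁻¹ • v) - f z)) hR2 (fun n => ?_) ?_
  · refine DifferentiableOn.const_smul (DifferentiableOn.sub ?_ (hd.mono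
      (ball_subset_ball (by linarith)))) _
    exact hd.comp (by fun_prop) fun z hz => hsub z hz (hadd n z hz)
  · rw [Metric.tendstoUniformlyOn_iff]
    intro ε hε
    have hlim : Tendsto (fun n : ℕ => (4 * M * ‖v‖ ^ 2 / (R / 2) ^ 2) * ((n : ℝ) + 1)⁻¹) atTop
        (𝓝 0) := by
      have := tendsto_one_div_add_atTop_nhds_zero_nat (𝕜 := ℝ)
      simpa using this.const_mul (4 * M * ‖v‖ ^ 2 / (R / 2) ^ 2)
    filter_upwards [hlim.eventually_lt_const hε] with n hn z hz
    have hT := norm_sub_sub_fderiv_le_of_norm_le_on_ball hR2 (hd.mono (hsub z hz))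
      (fun w hw => hM w (hsub z hz hw)) (hadd n z hz)
    rw [add_sub_cancel_left] at hT
    rw [dist_comm, dist_eq_norm]
    have h1 : t n • (f (z + (t n)⁻¹ • v) - f z) - fderiv ℂ f z v =
        t n • (f (z + (t n)⁻¹ • v) - f z - fderiv ℂ f z ((t n)⁻¹ • v)) := by
      rw [smul_sub (t n) (f (z + (t n)⁻¹ • v) - f z), map_smul, smul_inv_smul₀ (ht0 n)]
    rw [h1, norm_smul]
    refine lt_of_le_of_lt ?_ hn
    have hp : 0 < ‖t n‖ := norm_pos_iff.2 (ht0 n)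
    calc ‖t n‖ * _ ≤ ‖t n‖ * (4 * M * (‖(t n)⁻¹ • v‖ / (R / 2)) ^ 2) := by gcongr
      _ = (4 * M * ‖v‖ ^ 2 / (R / 2) ^ 2) * ‖t n‖⁻¹ := by
        rw [norm_smul, norm_inv]; field_simp
      _ ≤ _ := by
        gcongr
        rw [htn]; push_cast; linarith [(Nat.cast_nonneg N : (0:ℝ) ≤ N)]

/-- A holomorphic map is bounded on a small ball around each point. -/
theorem DifferentiableOn.exists_ball_norm_le {f : E → F} {U : Set E} (hd : DifferentiableOn ℂ f U)
    (hU : IsOpen U) {c : E} (hc : c ∈ U) :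
    ∃ R > 0, ball c R ⊆ U ∧ ∃ M, ∀ z ∈ ball c R, ‖f z‖ ≤ M := by
  have hcont := (hd.differentiableAt (hU.mem_nhds hc)).continuousAt
  obtain ⟨R, hR, h⟩ := Metric.mem_nhds_iff.1 (inter_mem (hU.mem_nhds hc)
    (hcont.norm.eventually_lt_const (lt_add_one ‖f c‖)))
  exact ⟨R, hR, fun z hz => (h hz).1, ‖f c‖ + 1, fun z hz => (h hz).2.le⟩

/-- The derivative of a holomorphic map is holomorphic. -/
theorem DifferentiableOn.fderiv_holomorphic [CompleteSpace F] {f : E → F} {U : Set E}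
    (hd : DifferentiableOn ℂ f U) (hU : IsOpen U) : DifferentiableOn ℂ (fderiv ℂ f) U := by
  intro c hc
  obtain ⟨R, hR, hRU, M, hM⟩ := hd.exists_ball_norm_le hU hc
  have hR2 : 0 < R / 2 := by positivity
  have hsub : ∀ z ∈ ball c (R / 2), ball z (R / 2) ⊆ ball c R := fun z hz =>
    ball_subset_ball' (by rw [mem_ball] at hz; linarith)
  refine (differentiableAt_clm_of_forall_apply hR2 (M := 2 * M / (R / 2)) (fun v z hz => ?_)
    fun z hz => ?_).differentiableWithinAt
  · exact (differentiableAt_fderiv_apply_of_norm_le_on_ball hR2 (hd.mono ((hsub z hz).trans hRU))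
      (fun w hw => hM w (hsub z hz hw)) v).differentiableWithinAt
  · exact norm_fderiv_le_of_norm_le_on_ball hR2 (hd.mono ((hsub z hz).trans hRU))
      fun w hw => hM w (hsub z hz hw)

/-- Holomorphic maps are smooth. -/
theorem DifferentiableOn.contDiffOn_of_isOpen {E : Type} [NormedAddCommGroup E] [NormedSpace ℂ E]
    [CompleteSpace F] {f : E → F} {U : Set E} (hd : DifferentiableOn ℂ f U) (hU : IsOpen U) :
    ContDiffOn ℂ ∞ f U := by
  refine contDiffOn_infty.2 fun n => ?_
  induction n generalizing F with
  | zero => exact contDiffOn_zero.2 hd.continuousOn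
  | succ n ih =>
    push_cast
    rw [contDiffOn_succ_iff_fderiv_of_isOpen hU]
    exact ⟨hd, by simp, ih (hd.fderiv_holomorphic hU)⟩

end SeveralVariables

/-! ### The sub-mean value inequality on balls of `ℂⁿ`. -/

section MeanValue

open Metric Filter Topology

variable {n : ℕ}

/-- Multiplication by a complex number of modulus one, as a real linear isometry of `ℂⁿ`. -/
noncomputable def rotationIsometry (n : ℕ) (u : ℂ) (hu : ‖u‖ = 1) : ComplexSpace n ≃ₗᵢ[ℝ] ComplexSpace n where
  toFun z := u • z
  map_add' x y := smul_add u x y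
  map_smul' c x := smul_comm u c x
  invFun z := u⁻¹ • z
  left_inv z := inv_smul_smul₀ (norm_ne_zero_iff.1 (by simp [hu])) z
  right_inv z := smul_inv_smul₀ (norm_ne_zero_iff.1 (by simp [hu])) z
  norm_map' z := by
    change ‖u • z‖ = ‖z‖
    rw [norm_smul, hu, one_mul]

/-- The one-variable mean value property applied to `ζ ↦ f (ζ • z)`. As the ball is open and
balanced, this slice is holomorphic up to the closed unit disk. -/
theorem enorm_le_lintegral_circle {f : ComplexSpace n → ℂ} {ρ : ℝ}
    (hd : DifferentiableOn ℂ f (ball 0 ρ)) {z : ComplexSpace n} (hz : z ∈ ball 0 ρ) :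
    ENNReal.ofReal (2 * Real.pi) * ‖f 0‖ₑ ≤
      ∫⁻ θ in Set.Ioc 0 (2 * Real.pi), ‖f (circleMap 0 1 θ • z)‖ₑ := by
  have hmaps : ∀ ζ : ℂ, ‖ζ‖ ≤ 1 → ζ • z ∈ ball (0 : ComplexSpace n) ρ := fun ζ hζ => by
    rw [mem_ball_zero_iff] at hz ⊢
    rw [norm_smul]
    exact (mul_le_of_le_one_left (norm_nonneg z) hζ).trans_lt hz
  have hda : ∀ ζ : ℂ, ‖ζ‖ ≤ 1 → DifferentiableAt ℂ (fun ζ : ℂ => f (ζ • z)) ζ := fun ζ hζ =>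
    (hd.differentiableAt (isOpen_ball.mem_nhds (hmaps ζ hζ))).comp ζ (by fun_prop)
  have hmv := circleAverage_of_differentiable_on_off_countable (f := fun ζ : ℂ => f (ζ • z))
    (c := 0) (R := 1) Set.countable_empty
    (fun ζ hζ => (hda ζ (by simpa using hζ)).continuousAt.continuousWithinAt)
    (fun ζ hζ => hda ζ (le_of_lt (by simpa using hζ.1)))
  rw [Real.circleAverage_def, zero_smul] at hmv
  have hpi : 0 < 2 * Real.pi := by positivity
  have h2 : (∫ θ in 0..2 * Real.pi, f (circleMap 0 1 θ • z)) = (2 * Real.pi) • f 0 := by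
    rw [← hmv, smul_inv_smul₀ hpi.ne']
  rw [intervalIntegral.integral_of_le hpi.le] at h2
  calc ENNReal.ofReal (2 * Real.pi) * ‖f 0‖ₑ = ‖(2 * Real.pi) • f 0‖ₑ := by
        rw [enorm_smul, Real.enorm_of_nonneg hpi.le]
    _ ≤ _ := by rw [← h2]; exact enorm_integral_le_lintegral_enorm _

/-- Integrating the circle inequality over the ball and exchanging the integrals suffices:
multiplication by a unimodular number preserves Lebesgue measure, so the integral in `z` does not
depend on `θ`. -/
theorem volume_ball_mul_enorm_le_of_center_zero {f : ComplexSpace n → ℂ} {ρ : ℝ}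
    (hd : DifferentiableOn ℂ f (ball 0 ρ)) :
    volume (ball (0 : ComplexSpace n) ρ) * ‖f 0‖ₑ ≤ ∫⁻ z in ball 0 ρ, ‖f z‖ₑ := by
  set G : ComplexSpace n → ℝ≥0∞ := (ball 0 ρ).indicator fun z => ‖f z‖ₑ with hG
  have hGm : Measurable G := by
    classical
    have : Measurable ((ball (0 : ComplexSpace n) ρ).indicator f) := by
      rw [← Set.piecewise_eq_indicator]
      exact hd.continuousOn.measurable_piecewise continuousOn_const isOpen_ball.measurableSet
    convert this.enorm using 2 with z
    by_cases hz : z ∈ ball (0 : ComplexSpace n) ρ <;> simp [hG, hz]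
  have hu : ∀ θ, ‖circleMap 0 1 θ‖ = 1 := fun θ => by simp
  have hball : ∀ θ z, circleMap 0 1 θ • z ∈ ball (0 : ComplexSpace n) ρ ↔ z ∈ ball 0 ρ :=
    fun θ z => by rw [mem_ball_zero_iff, mem_ball_zero_iff, norm_smul, hu, one_mul]
  have hrot : ∀ θ, ∫⁻ z, G (circleMap 0 1 θ • z) = ∫⁻ z, G z := fun θ =>
    (rotationIsometry n _ (hu θ)).measurePreserving.lintegral_comp hGm
  have hjoint : Measurable fun p : ComplexSpace n × ℝ => G (circleMap 0 1 p.2 • p.1) := by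
    refine hGm.comp (Continuous.measurable ?_)
    have : Continuous (circleMap 0 1) := continuous_circleMap 0 1
    fun_prop
  have hpi : ENNReal.ofReal (2 * Real.pi) ≠ 0 := by
    rw [Ne, ENNReal.ofReal_eq_zero, not_le]; positivity
  have key : ENNReal.ofReal (2 * Real.pi) * (volume (ball (0 : ComplexSpace n) ρ) * ‖f 0‖ₑ) ≤
      ENNReal.ofReal (2 * Real.pi) * ∫⁻ z, G z := by
    calc _ = ∫⁻ _ in ball (0 : ComplexSpace n) ρ, ENNReal.ofReal (2 * Real.pi) * ‖f 0‖ₑ := by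
          rw [setLIntegral_const]; ring
      _ ≤ ∫⁻ z in ball (0 : ComplexSpace n) ρ, ∫⁻ θ in Set.Ioc 0 (2 * Real.pi),
            G (circleMap 0 1 θ • z) := by
          refine setLIntegral_mono' isOpen_ball.measurableSet fun z hz => ?_
          refine (enorm_le_lintegral_circle hd hz).trans (le_of_eq ?_)
          refine lintegral_congr fun θ => ?_
          rw [hG, Set.indicator_of_mem ((hball θ z).2 hz)]
      _ ≤ ∫⁻ z, ∫⁻ θ in Set.Ioc 0 (2 * Real.pi), G (circleMap 0 1 θ • z) :=
          setLIntegral_le_lintegral _ _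
      _ = ∫⁻ θ in Set.Ioc 0 (2 * Real.pi), ∫⁻ z, G (circleMap 0 1 θ • z) :=
          lintegral_lintegral_swap hjoint.aemeasurable
      _ = _ := by
          simp_rw [hrot]
          rw [setLIntegral_const, Real.volume_Ioc, sub_zero, mul_comm]
  rw [ENNReal.mul_le_mul_iff_right hpi ENNReal.ofReal_ne_top] at key
  rwa [hG, lintegral_indicator isOpen_ball.measurableSet] at key

/-- The square of the modulus of a holomorphic function satisfies the sub-mean value inequality on
balls. -/
theorem volume_ball_mul_enorm_sq_le {f : ComplexSpace n → ℂ} {c : ComplexSpace n} {ρ : ℝ}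
    (hd : DifferentiableOn ℂ f (ball c ρ)) :
    volume (ball c ρ) * ‖f c‖ₑ ^ 2 ≤ ∫⁻ z in ball c ρ, ‖f z‖ₑ ^ 2 := by
  -- Squaring keeps holomorphy, so the inequality for a modulus already contains the one for its
  -- square.
  have hd0 : DifferentiableOn ℂ (fun z => f (z + c) ^ 2) (ball 0 ρ) := by
    refine DifferentiableOn.pow (hd.comp (by fun_prop) fun z hz => ?_) 2
    simpa [mem_ball, dist_eq_norm] using hz
  have h := volume_ball_mul_enorm_le_of_center_zero hd0
  have hpre : (fun z : ComplexSpace n => z + c) ⁻¹' ball c ρ = ball 0 ρ := by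
    ext z; simp [mem_ball, dist_eq_norm]
  have hmp := (measurePreserving_add_right (volume : Measure (ComplexSpace n)) c)
  have h1 : volume (ball (0 : ComplexSpace n) ρ) = volume (ball c ρ) := by
    rw [← hpre, hmp.measure_preimage isOpen_ball.measurableSet.nullMeasurableSet]
  have h2 := hmp.setLIntegral_comp_preimage_emb (measurableEmbedding_addRight c)
    (fun z => ‖f z‖ₑ ^ 2) (ball c ρ)
  rw [hpre] at h2
  simp only [zero_add, enorm_pow] at h
  rw [← h1, ← h2]
  exact h

end MeanValue

/-! ### Global charts and coefficients of canonical sections. -/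

section GlobalChart

open Filter Topology

variable {n : ℕ} {X : Type*} [TopologicalSpace X] [ChartedSpace (ComplexSpace n) X]

/-- `F` is a biholomorphism from `X` onto an open subset of `ℂⁿ`, with inverse `g`. -/
structure IsGlobalChart (F : X → ComplexSpace n) (g : ComplexSpace n → X) : Prop where
  mdifferentiable : MDifferentiable 𝓘(ℂ, ComplexSpace n) 𝓘(ℂ, ComplexSpace n) F
  isOpen_range : IsOpen (Set.range F)
  leftInverse : Function.LeftInverse g F
  mdifferentiableOn_symm :
    MDifferentiableOn 𝓘(ℂ, ComplexSpace n) 𝓘(ℂ, ComplexSpace n) g (Set.range F)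

/-- The standard basis of `ℂⁿ`. -/
noncomputable def standardBasis (n : ℕ) : Module.Basis (Fin n) ℂ (ComplexSpace n) :=
  (EuclideanSpace.basisFun (Fin n) ℂ).toBasis

theorem standardBasis_apply (j : Fin n) :
    standardBasis n j = EuclideanSpace.single j (1 : ℂ) := by
  simp [standardBasis]

theorem standardBasis_det_apply (m : Fin n → ComplexSpace n) :
    (standardBasis n).det m = Matrix.det (Matrix.of fun i j => m j i) := by
  rw [Module.Basis.det_apply]
  congr 1

theorem det_eq_matrix_det (A : ComplexSpace n →L[ℂ] ComplexSpace n) :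
    A.det = Matrix.det (Matrix.of fun i j => A (EuclideanSpace.single j 1) i) := by
  rw [← standardBasis_det_apply (fun j => A (EuclideanSpace.single j 1))]
  have h := (standardBasis n).det_comp (A : ComplexSpace n →ₗ[ℂ] ComplexSpace n) (standardBasis n)
  rw [Module.Basis.det_self, mul_one] at h
  rw [ContinuousLinearMap.det, ← h]
  congr 1
  ext1 j
  simp [standardBasis_apply]

/-- The volume form `dz₁ ∧ ⋯ ∧ dz_n` on `ℂⁿ`. -/
noncomputable def standardVolumeForm (n : ℕ) : ComplexSpace n [⋀^Fin n]→L[ℂ] ℂ :=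
  { (standardBasis n).det with
    cont := by
      change Continuous fun m : Fin n → ComplexSpace n => (standardBasis n).det m
      simp_rw [standardBasis_det_apply]
      refine Continuous.matrix_det (continuous_matrix fun i j => ?_)
      simp only [Matrix.of_apply]
      fun_prop }

/-- The pullback of `f` by `L` is an `n`-form on `ℂⁿ`, hence a multiple of the determinant; `L` need
not be invertible. -/
theorem ContinuousAlternatingMap.apply_comp_single {W : Type*} [AddCommGroup W] [Module ℂ W]
    [TopologicalSpace W] (f : W [⋀^Fin n]→L[ℂ] ℂ) (L : ComplexSpace n →L[ℂ] W)
    (A : ComplexSpace n →L[ℂ] ComplexSpace n) :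
    f (fun j => L (A (EuclideanSpace.single j 1))) =
      f (fun j => L (EuclideanSpace.single j 1)) * A.det := by
  set k := f.toAlternatingMap.compLinearMap (L : ComplexSpace n →ₗ[ℂ] W) with hk
  have h := k.eq_smul_basis_det (standardBasis n)
  have hs : ∀ j, standardBasis n j = EuclideanSpace.single j (1 : ℂ) := standardBasis_apply
  have h1 := congrArg (fun k' => k' (fun j => A (standardBasis n j))) h
  have h2 := (standardBasis n).det_comp (A : ComplexSpace n →ₗ[ℂ] ComplexSpace n) (standardBasis n)
  rw [Module.Basis.det_self, mul_one] at h2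
  have h3 : (standardBasis n).det (fun j => A (standardBasis n j)) = A.det := h2
  simp only [AlternatingMap.smul_apply, h3, smul_eq_mul] at h1
  simp only [hk, AlternatingMap.compLinearMap_apply] at h1
  simp only [hs] at h1
  exact h1

theorem differentiableOn_det {U : Set (ComplexSpace n)}
    {A : ComplexSpace n → ComplexSpace n →L[ℂ] ComplexSpace n} (hA : DifferentiableOn ℂ A U) :
    DifferentiableOn ℂ (fun z => (A z).det) U := by
  simp_rw [det_eq_matrix_det, Matrix.det_apply]
  refine DifferentiableOn.fun_sum fun τ _ => DifferentiableOn.const_smul ?_ _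
  simp only [Matrix.of_apply]
  intro z hz
  refine (HasFDerivWithinAt.finsetProd fun i _ =>
    DifferentiableWithinAt.hasFDerivWithinAt ?_).differentiableWithinAt
  refine (?_ : DifferentiableOn ℂ (fun z => A z (EuclideanSpace.single i 1) (τ i)) U) z hz
  exact (EuclideanSpace.proj (𝕜 := ℂ) (τ i)).differentiable.comp_differentiableOn
    (hA.clm_apply (differentiableOn_const _))

/-- The real Jacobian determinant of a complex linear map. -/
theorem abs_det_restrictScalars (A : ComplexSpace n →L[ℂ] ComplexSpace n) :
    |(A.restrictScalars ℝ).det| = ‖A.det‖ ^ 2 := by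
  have : (A.restrictScalars ℝ).det = Complex.normSq A.det := by
    rw [ContinuousLinearMap.det, ContinuousLinearMap.det, ← Algebra.norm_complex_apply,
      ← LinearMap.det_restrictScalars]
    rfl
  rw [this, Complex.normSq_eq_norm_sq, abs_of_nonneg (sq_nonneg _)]

namespace CanonicalSection

/-- The coefficient of a section of the canonical bundle in a parametrization `a`. -/
noncomputable def coeffAlong (σ : CanonicalSection n X) (a : ComplexSpace n → X)
    (z : ComplexSpace n) : ℂ :=
  σ (a z) fun j => mfderiv 𝓘(ℂ, ComplexSpace n) 𝓘(ℂ, ComplexSpace n) a z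
    (EuclideanSpace.single j (1 : ℂ) : ComplexSpace n)

theorem coeff_eq_coeffAlong (σ : CanonicalSection n X) (p : X) :
    σ.coeff p = σ.coeffAlong (chartAt (ComplexSpace n) p).symm := rfl

/-- The change of variables formula for the coefficients of a section of the canonical bundle. -/
theorem coeffAlong_comp (σ : CanonicalSection n X) {a b : ComplexSpace n → X}
    {T : ComplexSpace n → ComplexSpace n} {z : ComplexSpace n} (hT : DifferentiableAt ℂ T z)
    (hb : MDifferentiableAt 𝓘(ℂ, ComplexSpace n) 𝓘(ℂ, ComplexSpace n) b (T z))
    (h : a =ᶠ[𝓝 z] b ∘ T) :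
    σ.coeffAlong a z = σ.coeffAlong b (T z) * (fderiv ℂ T z).det := by
  have hd := (hb.hasMFDerivAt.comp z hT.hasFDerivAt.hasMFDerivAt).congr_of_eventuallyEq h
  -- All tangent spaces unfold to `ℂⁿ`, so the base point can be replaced without transporting the
  -- vectors `m`.
  have hpt : ∀ x y : X, x = y → ∀ m : Fin n → ComplexSpace n, σ x m = σ y m := by
    rintro x _ rfl m; rfl
  have h2 := hpt _ _ h.self_of_nhds fun j =>
    mfderiv 𝓘(ℂ, ComplexSpace n) 𝓘(ℂ, ComplexSpace n) a z
      (EuclideanSpace.single j (1 : ℂ) : ComplexSpace n)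
  rw [coeffAlong, h2, hd.mfderiv]
  exact ContinuousAlternatingMap.apply_comp_single (σ (b (T z)))
    (mfderiv 𝓘(ℂ, ComplexSpace n) 𝓘(ℂ, ComplexSpace n) b (T z)) (fderiv ℂ T z)

end CanonicalSection

variable (F : X → ComplexSpace n)

/-- The transition map from the chart at `p` to the global chart `F`. -/
noncomputable def globalTransition (p : X) : ComplexSpace n → ComplexSpace n :=
  F ∘ (chartAt (ComplexSpace n) p).symm

variable {F} {g : ComplexSpace n → X}

namespace IsGlobalChart

theorem injective (hF : IsGlobalChart F g) : Function.Injective F := hF.leftInverse.injective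

theorem rightInvOn (hF : IsGlobalChart F g) {w : ComplexSpace n} (hw : w ∈ Set.range F) :
    F (g w) = w := by
  obtain ⟨x, rfl⟩ := hw
  rw [hF.leftInverse x]

theorem continuous (hF : IsGlobalChart F g) : Continuous F := hF.mdifferentiable.continuous

theorem continuousOn_symm (hF : IsGlobalChart F g) : ContinuousOn g (Set.range F) :=
  hF.mdifferentiableOn_symm.continuousOn

theorem mdifferentiableAt_symm (hF : IsGlobalChart F g) {w : ComplexSpace n}
    (hw : w ∈ Set.range F) :
    MDifferentiableAt 𝓘(ℂ, ComplexSpace n) 𝓘(ℂ, ComplexSpace n) g w :=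
  (hF.mdifferentiableOn_symm w hw).mdifferentiableAt (hF.isOpen_range.mem_nhds hw)

/-- Through the embedding, `X` inherits second countability from `ℂⁿ`; this supplies the countable
cover used in gluing. -/
theorem isEmbedding (hF : IsGlobalChart F g) : Topology.IsEmbedding F := by
  have hr : Continuous fun y : Set.range F => g y :=
    continuousOn_iff_continuous_domRestrict.1 hF.continuousOn_symm
  have h : Topology.IsEmbedding (Set.rangeFactorization F) :=
    Topology.IsEmbedding.of_leftInverse (f := fun y : Set.range F => g y)
      (fun x => hF.leftInverse x) hr (hF.continuous.subtype_mk _)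
  exact Topology.IsEmbedding.subtypeVal.comp h

theorem globalTransition_mem_range (p : X) (z : ComplexSpace n) :
    globalTransition F p z ∈ Set.range F := ⟨_, rfl⟩

theorem comp_globalTransition (hF : IsGlobalChart F g) (p : X) (z : ComplexSpace n) :
    g (globalTransition F p z) = (chartAt (ComplexSpace n) p).symm z := hF.leftInverse _

theorem injOn_globalTransition (hF : IsGlobalChart F g) (p : X) :
    Set.InjOn (globalTransition F p) (chartAt (ComplexSpace n) p).target :=
  hF.injective.comp_injOn (chartAt (ComplexSpace n) p).symm.injOn

theorem mfderiv_comp_mfderiv_symm (hF : IsGlobalChart F g) {w : ComplexSpace n}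
    (hw : w ∈ Set.range F) (v : ComplexSpace n) :
    mfderiv 𝓘(ℂ, ComplexSpace n) 𝓘(ℂ, ComplexSpace n) F (g w)
      (mfderiv 𝓘(ℂ, ComplexSpace n) 𝓘(ℂ, ComplexSpace n) g w v) = v := by
  have h1 := (hF.mdifferentiable (g w)).hasMFDerivAt.comp w (hF.mdifferentiableAt_symm hw).hasMFDerivAt
  have h2 : HasMFDerivAt 𝓘(ℂ, ComplexSpace n) 𝓘(ℂ, ComplexSpace n) id w
      ((mfderiv 𝓘(ℂ, ComplexSpace n) 𝓘(ℂ, ComplexSpace n) F (g w)).comp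
      (mfderiv 𝓘(ℂ, ComplexSpace n) 𝓘(ℂ, ComplexSpace n) g w)) := by
    refine h1.congr_of_eventuallyEq ?_
    filter_upwards [hF.isOpen_range.mem_nhds hw] with y hy
    exact (hF.rightInvOn hy).symm
  have h3 := hasMFDerivAt_unique h2 (hasMFDerivAt_id w)
  exact congrArg (fun A : ComplexSpace n →L[ℂ] ComplexSpace n => A v) h3

theorem mfderiv_symm_comp_mfderiv (hF : IsGlobalChart F g) (x : X)
    (v : TangentSpace 𝓘(ℂ, ComplexSpace n) x) :
    mfderiv 𝓘(ℂ, ComplexSpace n) 𝓘(ℂ, ComplexSpace n) g (F x)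
      (mfderiv 𝓘(ℂ, ComplexSpace n) 𝓘(ℂ, ComplexSpace n) F x v) = v := by
  have h1 := (hF.mdifferentiableAt_symm ⟨x, rfl⟩).hasMFDerivAt.comp x
    (hF.mdifferentiable x).hasMFDerivAt
  have h2 : HasMFDerivAt 𝓘(ℂ, ComplexSpace n) 𝓘(ℂ, ComplexSpace n) id x
      ((mfderiv 𝓘(ℂ, ComplexSpace n) 𝓘(ℂ, ComplexSpace n) g (F x)).comp
      (mfderiv 𝓘(ℂ, ComplexSpace n) 𝓘(ℂ, ComplexSpace n) F x)) :=
    h1.congr_of_eventuallyEq (Eventually.of_forall fun y => (hF.leftInverse y).symm)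
  have h3 := hasMFDerivAt_unique h2 (hasMFDerivAt_id x)
  exact congrArg (fun A : ComplexSpace n →L[ℂ] ComplexSpace n => A v) h3

variable [IsManifold 𝓘(ℂ, ComplexSpace n) ω X]

theorem differentiableOn_globalTransition (hF : IsGlobalChart F g) (p : X) :
    DifferentiableOn ℂ (globalTransition F p) (chartAt (ComplexSpace n) p).target := by
  rw [← mdifferentiableOn_iff_differentiableOn]
  have h1 : MDifferentiableOn 𝓘(ℂ, ComplexSpace n) 𝓘(ℂ, ComplexSpace n)
      (chartAt (ComplexSpace n) p).symm (chartAt (ComplexSpace n) p).target :=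
    mdifferentiableOn_atlas_symm (chart_mem_atlas (ComplexSpace n) p)
  exact hF.mdifferentiable.comp_mdifferentiableOn h1

theorem differentiableAt_globalTransition (hF : IsGlobalChart F g) {p : X} {z : ComplexSpace n}
    (hz : z ∈ (chartAt (ComplexSpace n) p).target) :
    DifferentiableAt ℂ (globalTransition F p) z :=
  (hF.differentiableOn_globalTransition p).differentiableAt
    ((chartAt (ComplexSpace n) p).open_target.mem_nhds hz)

theorem coeff_eq (hF : IsGlobalChart F g) (σ : CanonicalSection n X) {p : X} {z : ComplexSpace n}
    (hz : z ∈ (chartAt (ComplexSpace n) p).target) :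
    σ.coeff p z = σ.coeffAlong g (globalTransition F p z) *
      (fderiv ℂ (globalTransition F p) z).det := by
  rw [CanonicalSection.coeff_eq_coeffAlong]
  refine σ.coeffAlong_comp (hF.differentiableAt_globalTransition hz)
    (hF.mdifferentiableAt_symm (globalTransition_mem_range p z)) (Eventually.of_forall fun y => ?_)
  exact (hF.comp_globalTransition p y).symm

/-- The coefficient of a holomorphic section in a global chart is holomorphic. -/
theorem differentiableOn_coeffAlong (hF : IsGlobalChart F g) {σ : CanonicalSection n X}
    (hσ : σ.IsHolomorphic) : DifferentiableOn ℂ (σ.coeffAlong g) (Set.range F) := by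
  intro w hw
  set e := chartAt (ComplexSpace n) (g w) with he
  set U : Set (ComplexSpace n) := Set.range F ∩ g ⁻¹' e.source with hU
  have hUo : IsOpen U := hF.continuousOn_symm.isOpen_inter_preimage hF.isOpen_range e.open_source
  have hwU : w ∈ U := ⟨hw, mem_chart_source (ComplexSpace n) (g w)⟩
  have hmd : MDifferentiableOn 𝓘(ℂ, ComplexSpace n) 𝓘(ℂ, ComplexSpace n) e e.source :=
    mdifferentiableOn_atlas (chart_mem_atlas (ComplexSpace n) (g w))
  have hTd : DifferentiableOn ℂ (e ∘ g) U := by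
    rw [← mdifferentiableOn_iff_differentiableOn]
    exact hmd.comp (hF.mdifferentiableOn_symm.mono Set.inter_subset_left) fun y hy => hy.2
  have hmaps : Set.MapsTo (e ∘ g) U e.target := fun y hy => e.map_source hy.2
  have hsm : MDifferentiableOn 𝓘(ℂ, ComplexSpace n) 𝓘(ℂ, ComplexSpace n) e.symm e.target :=
    mdifferentiableOn_atlas_symm (chart_mem_atlas (ComplexSpace n) (g w))
  have heq : ∀ y ∈ U, σ.coeffAlong g y =
      σ.coeff (g w) ((e ∘ g) y) * (fderiv ℂ (e ∘ g) y).det := by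
    intro y hy
    refine σ.coeffAlong_comp (hTd.differentiableAt (hUo.mem_nhds hy))
      ((hsm _ (hmaps hy)).mdifferentiableAt (e.open_target.mem_nhds (hmaps hy))) ?_
    filter_upwards [hUo.mem_nhds hy] with x hx
    exact (e.left_inv hx.2).symm
  have hdiff : DifferentiableOn ℂ (σ.coeffAlong g) U :=
    DifferentiableOn.congr (((hσ (g w)).comp hTd hmaps).mul
      (differentiableOn_det (hTd.fderiv_holomorphic hUo))) heq
  exact (hdiff.differentiableAt (hUo.mem_nhds hwU)).differentiableWithinAt

/-- A section whose coefficient in a global chart is holomorphic is holomorphic. -/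
theorem isHolomorphic_of_coeffAlong (hF : IsGlobalChart F g) {σ : CanonicalSection n X}
    (hσ : DifferentiableOn ℂ (σ.coeffAlong g) (Set.range F)) : σ.IsHolomorphic := by
  intro p
  have ht := hF.differentiableOn_globalTransition p
  refine DifferentiableOn.congr ((hσ.comp ht fun z _ => globalTransition_mem_range p z).mul
    (differentiableOn_det (ht.fderiv_holomorphic (chartAt (ComplexSpace n) p).open_target)))
    fun z hz => hF.coeff_eq σ hz

end IsGlobalChart

/-- The section of the canonical bundle whose coefficient in the global chart `F` is `h`. -/
noncomputable def sectionOfCoeff (F : X → ComplexSpace n) (h : ComplexSpace n → ℂ) :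
    CanonicalSection n X := fun x =>
  h (F x) • (standardVolumeForm n).compContinuousLinearMap
    (mfderiv 𝓘(ℂ, ComplexSpace n) 𝓘(ℂ, ComplexSpace n) F x)

theorem IsGlobalChart.coeffAlong_sectionOfCoeff
    (hF : IsGlobalChart F g) (h : ComplexSpace n → ℂ) {w : ComplexSpace n}
    (hw : w ∈ Set.range F) : (sectionOfCoeff F h).coeffAlong g w = h w := by
  change h (F (g w)) * (standardBasis n).det (fun j =>
    mfderiv 𝓘(ℂ, ComplexSpace n) 𝓘(ℂ, ComplexSpace n) F (g w)
      (mfderiv 𝓘(ℂ, ComplexSpace n) 𝓘(ℂ, ComplexSpace n) g w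
        (EuclideanSpace.single j (1 : ℂ)))) = h w
  simp_rw [hF.mfderiv_comp_mfderiv_symm hw, hF.rightInvOn hw, ← standardBasis_apply]
  rw [Module.Basis.det_self, mul_one]

end GlobalChart

/-! ### Gluing chart measures and integrating in a global chart. -/

section Gluing

open Filter Topology

variable {n : ℕ} {X : Type*} [TopologicalSpace X] [ChartedSpace (ComplexSpace n) X]
  {F : X → ComplexSpace n} {g : ComplexSpace n → X}

/-- A measure obtained by gluing is determined on a countable cover. -/
theorem iSup_measure_eq_of_restrict_eq {α ι : Type*} [MeasurableSpace α] {μ : Measure α}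
    {ν : ι → Measure α} {U : ι → Set α} (hU : ∀ i, MeasurableSet (U i))
    (hν : ∀ i, ν i = μ.restrict (U i)) {t : Set ι} (ht : t.Countable)
    (hcover : ⋃ i ∈ t, U i = Set.univ) : ⨆ i, ν i = μ := by
  refine le_antisymm (iSup_le fun i => (hν i).trans_le Measure.restrict_le_self) ?_
  have hle : ⨆ i, ν i ≤ μ := iSup_le fun i => (hν i).trans_le Measure.restrict_le_self
  -- The supremum may run over uncountably many indices, but equality with `μ` need only be checked
  -- on the countable subcover.
  have := ht.to_subtype
  refine le_of_eq (Measure.ext_of_iUnion_eq_univ (s := fun i : t => U i)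
    (by rwa [← Set.biUnion_eq_iUnion t fun i _ => U i]) fun i => le_antisymm ?_ ?_)
  · calc μ.restrict (U i) = (ν i).restrict (U i) := by
          rw [hν, Measure.restrict_restrict (hU i), Set.inter_self]
      _ ≤ _ := Measure.restrict_mono_measure (le_iSup ν (i : ι)) _
  · exact Measure.restrict_mono_measure hle _

variable [IsManifold 𝓘(ℂ, ComplexSpace n) ω X]

/-- The integral of a density over `X` can be computed in a global chart. -/
theorem IsGlobalChart.lintegralDensity_eq (hF : IsGlobalChart F g) {d : X → ComplexSpace n → ℝ≥0∞}
    {D : ComplexSpace n → ℝ≥0∞}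
    (hd : ∀ p, ∀ z ∈ (chartAt (ComplexSpace n) p).target, d p z =
      ENNReal.ofReal (‖(fderiv ℂ (globalTransition F p) z).det‖ ^ 2) *
        D (globalTransition F p z)) :
    lintegralDensity d = ∫⁻ w in Set.range F, D w := by
  let _ : MeasurableSpace X := borel X
  have _ : BorelSpace X := ⟨rfl⟩
  have := hF.isEmbedding.secondCountableTopology
  set e := fun p : X => chartAt (ComplexSpace n) p with he
  -- This is the glued measure: each chart measure turns out to be its restriction to the chart
  -- domain.
  set μ : Measure X := Measure.map g ((volume.restrict (Set.range F)).withDensity D) with hμ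
  have hμA : ∀ A : Set X, MeasurableSet A → μ A = ∫⁻ w in F '' A, D w := by
    intro A hA
    have hg : AEMeasurable g ((volume.restrict (Set.range F)).withDensity D) :=
      (hF.continuousOn_symm.aemeasurable hF.isOpen_range.measurableSet).mono_ac
        (withDensity_absolutelyContinuous _ _)
    rw [hμ, Measure.map_apply_of_aemeasurable hg hA, withDensity_apply',
      Measure.restrict_restrict' hF.isOpen_range.measurableSet]
    congr 2
    ext w
    constructor
    · rintro ⟨hw, hr⟩
      exact ⟨g w, hw, hF.rightInvOn hr⟩
    · rintro ⟨x, hx, rfl⟩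
      refine ⟨?_, x, rfl⟩
      rw [Set.mem_preimage, hF.leftInverse x]; exact hx
  have hν : ∀ p : X, Measure.map (e p).symm ((volume.restrict (e p).target).withDensity (d p)) =
      μ.restrict (e p).source := by
    intro p
    have hto : MeasurableSet (e p).target := (e p).open_target.measurableSet
    have hcont : ContinuousOn (e p).symm (e p).target := (e p).continuousOn_symm
    ext A hA
    have hsm : AEMeasurable (e p).symm ((volume.restrict (e p).target).withDensity (d p)) :=
      (hcont.aemeasurable hto).mono_ac (withDensity_absolutelyContinuous _ _)
    have hmeas : MeasurableSet ((e p).symm ⁻¹' A ∩ (e p).target) := by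
      have h1 : Continuous ((e p).target.domRestrict (e p).symm) :=
        continuousOn_iff_continuous_domRestrict.1 hcont
      have h2 := hto.subtype_image (h1.measurable hA)
      convert h2 using 1
      ext z
      simp [and_comm]
    rw [Measure.map_apply_of_aemeasurable hsm hA, withDensity_apply',
      Measure.restrict_restrict' hto, Measure.restrict_apply hA,
      hμA _ (hA.inter (e p).open_source.measurableSet)]
    have himg : F '' (A ∩ (e p).source) =
        globalTransition F p '' ((e p).symm ⁻¹' A ∩ (e p).target) := by
      rw [globalTransition, Set.image_comp]
      congr 1
      ext x
      constructor
      · rintro ⟨hxA, hxs⟩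
        refine ⟨e p x, ⟨?_, (e p).map_source hxs⟩, (e p).left_inv hxs⟩
        rw [Set.mem_preimage, (e p).left_inv hxs]; exact hxA
      · rintro ⟨z, ⟨hzA, hzt⟩, rfl⟩
        exact ⟨hzA, (e p).map_target hzt⟩
    -- The real Jacobian of a complex differentiable map is the squared modulus of the complex
    -- determinant, exactly the factor in `hd`.
    rw [himg, lintegral_image_eq_lintegral_abs_det_fderiv_mul volume hmeas
      (f' := fun z => (fderiv ℂ (globalTransition F p) z).restrictScalars ℝ)
      (fun z hz => ((hF.differentiableAt_globalTransition hz.2).hasFDerivAt.restrictScalars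
        ℝ).hasFDerivWithinAt)
      ((hF.injOn_globalTransition p).mono Set.inter_subset_right)]
    refine setLIntegral_congr_fun hmeas fun z hz => ?_
    simp only [abs_det_restrictScalars]
    exact hd p z hz.2
  obtain ⟨t, ht, hcover⟩ := TopologicalSpace.countable_cover_nhds
    (f := fun p => (e p).source) fun p => (e p).open_source.mem_nhds (mem_chart_source _ p)
  have hsup := iSup_measure_eq_of_restrict_eq (fun p => (e p).open_source.measurableSet) hν ht hcover
  change (⨆ p : X, Measure.map (e p).symm ((volume.restrict (e p).target).withDensity (d p)))
    Set.univ = _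
  rw [hsup, hμA _ MeasurableSet.univ, Set.image_univ]

/-- `2ⁿ` times Lebesgue measure on a domain, the measure attached to `(√-1)^(n²) dz ∧ dz̄`. -/
noncomputable def domainMeasure (D : Set (ComplexSpace n)) : Measure (ComplexSpace n) :=
  (2 ^ n : ℝ≥0∞) • volume.restrict D

theorem lintegral_domainMeasure (D : Set (ComplexSpace n)) (f : ComplexSpace n → ℝ≥0∞) :
    ∫⁻ w, f w ∂domainMeasure D = 2 ^ n * ∫⁻ w in D, f w := by
  rw [domainMeasure, lintegral_smul_measure, smul_eq_mul]

theorem ofReal_two_pow_mul (x : ℝ) :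
    ENNReal.ofReal (2 ^ n * x) = 2 ^ n * ENNReal.ofReal x := by
  rw [ENNReal.ofReal_mul (by positivity), ENNReal.ofReal_pow zero_le_two, ENNReal.ofReal_ofNat]

namespace IsGlobalChart

theorem normSq_eq (hF : IsGlobalChart F g) (σ : CanonicalSection n X) :
    σ.normSq = ∫⁻ w, ‖σ.coeffAlong g w‖ₑ ^ 2 ∂domainMeasure (Set.range F) := by
  rw [lintegral_domainMeasure, CanonicalSection.normSq,
    hF.lintegralDensity_eq (D := fun w => 2 ^ n * ‖σ.coeffAlong g w‖ₑ ^ 2)]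
  · rw [lintegral_const_mul' _ _ (by finiteness)]
  · intro p z hz
    rw [hF.coeff_eq σ hz, ofReal_two_pow_mul, norm_mul, mul_pow,
      ENNReal.ofReal_mul (sq_nonneg _), ENNReal.ofReal_pow (norm_nonneg _) (p := ‖σ.coeffAlong g _‖),
      ofReal_norm]
    ring

theorem lintegralDensity_ofReal_eq (hF : IsGlobalChart F g) {d : X → ComplexSpace n → ℝ}
    {D : ComplexSpace n → ℝ}
    (hd : ∀ p, ∀ z ∈ (chartAt (ComplexSpace n) p).target, d p z =
      2 ^ n * (‖(fderiv ℂ (globalTransition F p) z).det‖ ^ 2 * D (globalTransition F p z))) :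
    lintegralDensity (fun p z => ENNReal.ofReal (d p z)) =
      ∫⁻ w, ENNReal.ofReal (D w) ∂domainMeasure (Set.range F) := by
  rw [lintegral_domainMeasure,
    hF.lintegralDensity_eq (D := fun w => 2 ^ n * ENNReal.ofReal (D w))]
  · rw [lintegral_const_mul' _ _ (by finiteness)]
  · intro p z hz
    rw [hd p z hz, ofReal_two_pow_mul, ENNReal.ofReal_mul (sq_nonneg _)]
    ring

/-- Integrability makes the positive and negative parts finite, so that their `toReal` differences
recombine into the Bochner integral. -/
theorem innerProduct_eq (hF : IsGlobalChart F g) (σ ρ : CanonicalSection n X)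
    (hint : Integrable (fun w => σ.coeffAlong g w * (starRingEnd ℂ) (ρ.coeffAlong g w))
      (domainMeasure (Set.range F))) :
    CanonicalSection.innerProduct σ ρ =
      ∫ w, σ.coeffAlong g w * (starRingEnd ℂ) (ρ.coeffAlong g w)
        ∂domainMeasure (Set.range F) := by
  have hkey : ∀ p, ∀ z ∈ (chartAt (ComplexSpace n) p).target,
      (2 ^ n * (σ.coeff p z * (starRingEnd ℂ) (ρ.coeff p z)) : ℂ) =
      ((2 ^ n * ‖(fderiv ℂ (globalTransition F p) z).det‖ ^ 2 : ℝ) : ℂ) *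
        (σ.coeffAlong g (globalTransition F p z) *
          (starRingEnd ℂ) (ρ.coeffAlong g (globalTransition F p z))) := by
    intro p z hz
    rw [hF.coeff_eq σ hz, hF.coeff_eq ρ hz, map_mul]
    push_cast
    rw [← Complex.mul_conj']
    ring
  rw [CanonicalSection.innerProduct, integralDensity]
  set H := fun w => σ.coeffAlong g w * (starRingEnd ℂ) (ρ.coeffAlong g w) with hH
  rw [hF.lintegralDensity_ofReal_eq (D := fun w => (H w).re),
    hF.lintegralDensity_ofReal_eq (D := fun w => -(H w).re),
    hF.lintegralDensity_ofReal_eq (D := fun w => (H w).im),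
    hF.lintegralDensity_ofReal_eq (D := fun w => -(H w).im)]
  · have hre := integral_eq_lintegral_pos_part_sub_lintegral_neg_part hint.re
    have him := integral_eq_lintegral_pos_part_sub_lintegral_neg_part hint.im
    simp only [RCLike.re_eq_complex_re, RCLike.im_eq_complex_im] at hre him
    rw [← hre, ← him]
    exact integral_re_add_im hint
  all_goals
    intro p z hz
    rw [hkey p z hz]
    simp only [hH, Complex.re_ofReal_mul, Complex.im_ofReal_mul]
    ring

end IsGlobalChart

end Gluing

/-! ### The Bergman space as a subspace of `L²`. -/

section Realization

open Filter Topology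

variable {n : ℕ} {X : Type*} [TopologicalSpace X] [ChartedSpace (ComplexSpace n) X]
  {F : X → ComplexSpace n} {g : ComplexSpace n → X}

theorem memLp_two_iff_lintegral {α : Type*} [MeasurableSpace α] {μ : Measure α} {f : α → ℂ}
    (hf : AEStronglyMeasurable f μ) : MemLp f 2 μ ↔ ∫⁻ w, ‖f w‖ₑ ^ 2 ∂μ < ⊤ := by
  have h := eLpNorm_lt_top_iff_lintegral_rpow_enorm_lt_top (f := f) (μ := μ) two_ne_zero
    ENNReal.ofNat_ne_top
  simp only [ENNReal.toReal_ofNat, ENNReal.rpow_ofNat] at h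
  rw [MemLp, h]
  exact and_iff_right hf

theorem enorm_toLp_sq {α : Type*} [MeasurableSpace α] {μ : Measure α} {f : α → ℂ}
    (hf : MemLp f 2 μ) : ‖hf.toLp f‖ₑ ^ 2 = ∫⁻ w, ‖f w‖ₑ ^ 2 ∂μ := by
  rw [Lp.enorm_toLp, eLpNorm_eq_lintegral_rpow_enorm_toReal two_ne_zero ENNReal.ofNat_ne_top]
  simp only [ENNReal.toReal_ofNat, ENNReal.rpow_ofNat, one_div]
  rw [← ENNReal.rpow_natCast, ← ENNReal.rpow_mul]
  norm_num

/-- `S` identifies the inner product space `V` with the space of square-integrable holomorphic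
sections of the canonical bundle. -/
structure IsBergmanModel {V : Type*} [NormedAddCommGroup V] [InnerProductSpace ℂ V]
    (S : V →ₗ[ℂ] CanonicalSection n X) : Prop where
  range_eq : Set.range S = CanonicalSection.bergmanSpace n X
  normSq_eq : ∀ x, (S x).normSq = ‖x‖ₑ ^ 2
  innerProduct_eq : ∀ x y, CanonicalSection.innerProduct (S x) (S y) = inner ℂ y x

/-- Every `n`-tuple of tangent vectors is the image of the standard basis under a linear map
followed by the differential of `g`, so a top form only sees its coefficient times a determinant. -/
theorem IsGlobalChart.eq_zero_of_coeffAlong (hF : IsGlobalChart F g) {σ : CanonicalSection n X}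
    (h : ∀ w ∈ Set.range F, σ.coeffAlong g w = 0) : σ = 0 := by
  funext x
  have hpt : ∀ x y : X, x = y → ∀ m : Fin n → ComplexSpace n, σ x m = σ y m := by
    rintro x _ rfl m; rfl
  refine ContinuousAlternatingMap.ext fun m => ?_
  let m' : Fin n → ComplexSpace n := fun j =>
    mfderiv 𝓘(ℂ, ComplexSpace n) 𝓘(ℂ, ComplexSpace n) F x (m j)
  let A : ComplexSpace n →L[ℂ] ComplexSpace n := LinearMap.toContinuousLinearMap
    ((standardBasis n).constr ℂ m')
  have hAj : ∀ j, A (EuclideanSpace.single j 1) =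
      mfderiv 𝓘(ℂ, ComplexSpace n) 𝓘(ℂ, ComplexSpace n) F x (m j) := fun j => by
    rw [← standardBasis_apply]
    exact (standardBasis n).constr_basis ℂ m' j
  have h1 := ContinuousAlternatingMap.apply_comp_single (σ (g (F x)))
    (mfderiv 𝓘(ℂ, ComplexSpace n) 𝓘(ℂ, ComplexSpace n) g (F x)) A
  simp_rw [hAj] at h1
  have h2 : (fun j => (mfderiv 𝓘(ℂ, ComplexSpace n) 𝓘(ℂ, ComplexSpace n) g (F x)
      (mfderiv 𝓘(ℂ, ComplexSpace n) 𝓘(ℂ, ComplexSpace n) F x (m j)) : ComplexSpace n)) = m :=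
    funext fun j => hF.mfderiv_symm_comp_mfderiv x (m j)
  have h3 : σ (g (F x)) m = σ.coeffAlong g (F x) * A.det := by
    refine Eq.trans ?_ h1
    exact congrArg (fun k : Fin n → ComplexSpace n => σ (g (F x)) k) h2.symm
  rw [h _ ⟨x, rfl⟩, zero_mul] at h3
  exact (hpt _ _ (hF.leftInverse x).symm m).trans h3

theorem aestronglyMeasurable_domainMeasure {D : Set (ComplexSpace n)} (hD : IsOpen D)
    {f : ComplexSpace n → ℂ} (hf : ContinuousOn f D) :
    AEStronglyMeasurable f (domainMeasure D) :=
  (hf.aestronglyMeasurable hD.measurableSet).smul_measure _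

variable [IsManifold 𝓘(ℂ, ComplexSpace n) ω X]

theorem IsGlobalChart.memLp_coeffAlong (hF : IsGlobalChart F g) {σ : CanonicalSection n X}
    (hσ : σ ∈ CanonicalSection.bergmanSpace n X) :
    MemLp (σ.coeffAlong g) 2 (domainMeasure (Set.range F)) := by
  rw [memLp_two_iff_lintegral (aestronglyMeasurable_domainMeasure hF.isOpen_range
    (hF.differentiableOn_coeffAlong hσ.1).continuousOn), ← hF.normSq_eq]
  exact hσ.2

theorem IsGlobalChart.mem_bergmanSpace (hF : IsGlobalChart F g) {σ : CanonicalSection n X}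
    (hd : DifferentiableOn ℂ (σ.coeffAlong g) (Set.range F))
    (hm : MemLp (σ.coeffAlong g) 2 (domainMeasure (Set.range F))) :
    σ ∈ CanonicalSection.bergmanSpace n X := by
  refine ⟨hF.isHolomorphic_of_coeffAlong hd, ?_⟩
  rw [hF.normSq_eq]
  exact (memLp_two_iff_lintegral hm.1).1 hm

/-- The space of square-integrable holomorphic sections as a linear subspace. -/
noncomputable def IsGlobalChart.bergmanSubmodule (hF : IsGlobalChart F g) :
    Submodule ℂ (CanonicalSection n X) where
  carrier := CanonicalSection.bergmanSpace n X
  add_mem' hσ hτ := hF.mem_bergmanSpace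
    ((hF.differentiableOn_coeffAlong hσ.1).add (hF.differentiableOn_coeffAlong hτ.1))
    ((hF.memLp_coeffAlong hσ).add (hF.memLp_coeffAlong hτ))
  zero_mem' := hF.mem_bergmanSpace (σ := 0) (differentiableOn_const 0) MemLp.zero
  smul_mem' c _ hσ := hF.mem_bergmanSpace
    ((hF.differentiableOn_coeffAlong hσ.1).const_mul c)
    ((hF.memLp_coeffAlong hσ).const_mul c)

/-- The embedding of the Bergman space into `L²` of the image of a global chart. -/
noncomputable def IsGlobalChart.bergmanToLp (hF : IsGlobalChart F g) :
    hF.bergmanSubmodule →ₗ[ℂ] Lp ℂ 2 (domainMeasure (Set.range F)) where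
  toFun σ := (hF.memLp_coeffAlong σ.2).toLp
  map_add' σ τ := MemLp.toLp_add (hF.memLp_coeffAlong σ.2) (hF.memLp_coeffAlong τ.2)
  map_smul' c σ := MemLp.toLp_const_smul c (hF.memLp_coeffAlong σ.2)

/-- Coefficients are continuous, so almost everywhere equality on the open image is equality there,
and the coefficient determines the section. -/
theorem IsGlobalChart.bergmanToLp_injective (hF : IsGlobalChart F g) :
    Function.Injective hF.bergmanToLp := by
  intro σ τ h
  have h0 : (σ : CanonicalSection n X).coeffAlong g =ᵐ[domainMeasure (Set.range F)]
      (τ : CanonicalSection n X).coeffAlong g :=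
    (MemLp.toLp_eq_toLp_iff (hF.memLp_coeffAlong σ.2) (hF.memLp_coeffAlong τ.2)).1 h
  have h1 : (σ : CanonicalSection n X).coeffAlong g =ᵐ[volume.restrict (Set.range F)]
      (τ : CanonicalSection n X).coeffAlong g := by
    rwa [EventuallyEq, domainMeasure, Measure.ae_ennreal_smul_measure_eq (by positivity)] at h0
  have h2 := Measure.eqOn_open_of_ae_eq h1 hF.isOpen_range
    (hF.differentiableOn_coeffAlong σ.2.1).continuousOn
    (hF.differentiableOn_coeffAlong τ.2.1).continuousOn
  refine Subtype.ext (sub_eq_zero.1 (hF.eq_zero_of_coeffAlong fun w hw => ?_))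
  exact sub_eq_zero.2 (h2 hw)

/-- The Bergman space is a separable inner product space. -/
theorem IsGlobalChart.exists_isBergmanModel (hF : IsGlobalChart F g) :
    ∃ (V : Type) (_ : NormedAddCommGroup V) (_ : InnerProductSpace ℂ V)
      (_ : TopologicalSpace.SeparableSpace V) (S : V →ₗ[ℂ] CanonicalSection n X),
      IsBergmanModel S := by
  -- This fact and the s-finiteness below serve the instance search for separability of `L²`.
  have : Fact ((2 : ℝ≥0∞) ≠ ⊤) := ⟨ENNReal.ofNat_ne_top⟩
  have : SFinite (domainMeasure (Set.range F)) := by unfold domainMeasure; infer_instance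
  let e := LinearEquiv.ofInjective hF.bergmanToLp hF.bergmanToLp_injective
  have hx : ∀ x : LinearMap.range hF.bergmanToLp, (x : Lp ℂ 2 (domainMeasure (Set.range F))) =
      (hF.memLp_coeffAlong (e.symm x).2).toLp := fun x => by
    conv_lhs => rw [← e.apply_symm_apply x]
    rfl
  refine ⟨LinearMap.range hF.bergmanToLp, inferInstance, inferInstance, inferInstance,
    hF.bergmanSubmodule.subtype ∘ₗ e.symm.toLinearMap, ?_, fun x => ?_, fun x y => ?_⟩
  · ext σ
    constructor
    · rintro ⟨x, rfl⟩
      exact (e.symm x).2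
    · intro hσ
      exact ⟨e ⟨σ, hσ⟩, by simp⟩
  · rw [hF.normSq_eq]
    have : ‖x‖ₑ = ‖(x : Lp ℂ 2 (domainMeasure (Set.range F)))‖ₑ := rfl
    rw [this, hx x, enorm_toLp_sq]
    rfl
  · have h1 : (inner ℂ y x : ℂ) = inner ℂ (y : Lp ℂ 2 (domainMeasure (Set.range F))) x := rfl
    have hcongr : (fun w => inner ℂ ((y : Lp ℂ 2 (domainMeasure (Set.range F))) w)
        ((x : Lp ℂ 2 (domainMeasure (Set.range F))) w)) =ᵐ[domainMeasure (Set.range F)]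
        fun w => ((e.symm x : CanonicalSection n X)).coeffAlong g w *
          (starRingEnd ℂ) (((e.symm y : CanonicalSection n X)).coeffAlong g w) := by
      have h2 := (hF.memLp_coeffAlong (e.symm x).2).coeFn_toLp
      have h3 := (hF.memLp_coeffAlong (e.symm y).2).coeFn_toLp
      rw [← hx] at h2 h3
      filter_upwards [h2, h3] with w hw1 hw2
      rw [hw1, hw2, RCLike.inner_apply]
    rw [h1, L2.inner_def, integral_congr_ae hcongr]
    exact hF.innerProduct_eq _ _ ((L2.integrable_inner _ _).congr hcongr)

end Realization

/-! ### Orthonormal bases and Parseval's identity for functionals. -/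

section OrthonormalBases

open Filter Topology

variable {V : Type*} [NormedAddCommGroup V] [InnerProductSpace ℂ V]

theorem inner_self_eq_ofReal_norm_sq (x : V) : (inner ℂ x x : ℂ) = ((‖x‖ ^ 2 : ℝ) : ℂ) := by
  rw [inner_self_eq_norm_sq_to_K]; norm_cast

/-- A separable inner product space has an orthonormal subset with dense span. -/
theorem exists_orthonormal_dense_span [TopologicalSpace.SeparableSpace V] :
    ∃ u : Set V, Orthonormal ℂ (Subtype.val : u → V) ∧ Dense (Submodule.span ℂ u : Set V) := by
  set f := TopologicalSpace.denseSeq V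
  set e := InnerProductSpace.gramSchmidtNormed ℂ f with he
  refine ⟨_, (InnerProductSpace.gramSchmidtNormed_orthonormal' f).toSubtypeRange, ?_⟩
  refine (TopologicalSpace.denseRange_denseSeq V).mono ?_
  have h1 : Submodule.span ℂ (Set.range e) = Submodule.span ℂ (Set.range f) :=
    (InnerProductSpace.span_gramSchmidtNormed_range f).trans
      (InnerProductSpace.span_gramSchmidt ℂ f)
  -- Gram–Schmidt returns `0` at dependent vectors; discarding these zeros does not shrink the span.
  have h2 : Submodule.span ℂ (Set.range e) ≤
      Submodule.span ℂ (Set.range fun i : { i | e i ≠ 0 } => e i) := by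
    rw [Submodule.span_le]
    rintro _ ⟨i, rfl⟩
    by_cases hi : e i = 0
    · rw [hi]; exact Submodule.zero_mem _
    · exact Submodule.subset_span ⟨⟨i, hi⟩, rfl⟩
  intro x hx
  exact h2 (h1 ▸ Submodule.subset_span hx)

variable {n : ℕ} {X : Type*} [TopologicalSpace X] [ChartedSpace (ComplexSpace n) X]
  {S : V →ₗ[ℂ] CanonicalSection n X}

namespace IsBergmanModel

theorem mem_bergmanSpace (hS : IsBergmanModel S) (x : V) :
    S x ∈ CanonicalSection.bergmanSpace n X := hS.range_eq ▸ ⟨x, rfl⟩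

theorem isOrthonormalBasis_image (hS : IsBergmanModel S) {u : Set V}
    (hu : Orthonormal ℂ (Subtype.val : u → V)) (hd : Dense (Submodule.span ℂ u : Set V)) :
    CanonicalSection.IsOrthonormalBasis (S '' u) where
  mem_bergmanSpace := by
    rintro _ ⟨x, _, rfl⟩
    exact hS.mem_bergmanSpace x
  inner_self := by
    rintro _ ⟨x, hx, rfl⟩
    rw [hS.innerProduct_eq, inner_self_eq_norm_sq_to_K, hu.1 ⟨x, hx⟩]
    simp
  inner_eq_zero := by
    rintro _ ⟨x, hx, rfl⟩ _ ⟨y, hy, rfl⟩ hxy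
    rw [hS.innerProduct_eq]
    exact hu.2 (i := ⟨y, hy⟩) (j := ⟨x, hx⟩) fun h => hxy (congrArg S (Subtype.ext_iff.1 h).symm)
  dense_span := by
    intro τ hτ ε hε
    rw [← hS.range_eq] at hτ
    obtain ⟨x, rfl⟩ := hτ
    obtain ⟨δ, hδ, hδε⟩ : ∃ δ : ℝ≥0∞, 0 < δ ∧ δ ^ 2 ≤ ε := by
      refine ⟨min ε 1, lt_min hε one_pos, ?_⟩
      rw [pow_two]
      exact (mul_le_mul' (min_le_left _ _) (min_le_right _ _)).trans_eq (mul_one _)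
    obtain ⟨y, hy, hxy⟩ := EMetric.mem_closure_iff.1 (hd x) δ hδ
    refine ⟨S y, ?_, ?_⟩
    · rw [← Submodule.map_span]
      exact Submodule.mem_map_of_mem hy
    · rw [← map_sub, hS.normSq_eq, ← edist_eq_enorm_sub]
      exact (ENNReal.pow_lt_pow_left two_ne_zero hxy).trans_le hδε

/-- An orthonormal basis of the Bergman space corresponds to an orthonormal family with dense
span in a model. -/
theorem exists_orthonormal_family (hS : IsBergmanModel S) {s : Set (CanonicalSection n X)}
    (hs : CanonicalSection.IsOrthonormalBasis s) :
    ∃ v : s → V, (∀ σ, S (v σ) = σ) ∧ Orthonormal ℂ v ∧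
      Dense (Submodule.span ℂ (Set.range v) : Set V) := by
  have hex : ∀ σ : s, ∃ x, S x = σ := fun σ => by
    have := hs.mem_bergmanSpace σ.2
    rwa [← hS.range_eq] at this
  choose v hv using hex
  refine ⟨v, hv, ⟨fun σ => ?_, fun σ τ h => ?_⟩, fun x => ?_⟩
  · have h1 := hs.inner_self σ σ.2
    rw [← hv σ, hS.innerProduct_eq, inner_self_eq_ofReal_norm_sq] at h1
    have h2 : ‖v σ‖ ^ 2 = 1 := by exact_mod_cast h1
    exact (pow_eq_one_iff_of_nonneg (norm_nonneg _) two_ne_zero).1 h2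
  · have h1 := hs.inner_eq_zero τ τ.2 σ σ.2 fun h' => h (Subtype.ext h'.symm)
    rwa [← hv σ, ← hv τ, hS.innerProduct_eq] at h1
  · refine EMetric.mem_closure_iff.2 fun ε hε => ?_
    obtain ⟨ρ, hρ, hlt⟩ := hs.dense_span (S x) (hS.mem_bergmanSpace x) (ε ^ 2) (by positivity)
    have hsr : s = S '' Set.range v := by
      ext σ
      constructor
      · exact fun hσ => ⟨v ⟨σ, hσ⟩, ⟨_, rfl⟩, hv _⟩
      · rintro ⟨_, ⟨τ, rfl⟩, rfl⟩
        rw [hv]; exact τ.2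
    rw [hsr, ← Submodule.map_span] at hρ
    obtain ⟨y, hy, rfl⟩ := hρ
    refine ⟨y, hy, ?_⟩
    rw [← map_sub, hS.normSq_eq, ← edist_eq_enorm_sub] at hlt
    by_contra hle
    exact (pow_le_pow_left' (not_lt.1 hle) 2).not_gt hlt

end IsBergmanModel

section DualCoordinates

variable {ι : Type*} {v : ι → V}

/-- Bessel's inequality without Riesz representation, since `V` need not be complete: `φ` is tested
on the finite sum of the vectors `conj (φ (v i)) • v i`. -/
theorem Orthonormal.sum_norm_sq_apply_le (hv : Orthonormal ℂ v) (φ : StrongDual ℂ V)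
    (t : Finset ι) : ∑ i ∈ t, ‖φ (v i)‖ ^ 2 ≤ ‖φ‖ ^ 2 := by
  set T := ∑ i ∈ t, ‖φ (v i)‖ ^ 2 with hT
  have hT0 : 0 ≤ T := Finset.sum_nonneg fun _ _ => sq_nonneg _
  set x := ∑ i ∈ t, (starRingEnd ℂ) (φ (v i)) • v i with hx
  have h1 : φ x = (T : ℂ) := by
    rw [hx, map_sum, hT]
    push_cast
    refine Finset.sum_congr rfl fun i _ => ?_
    rw [map_smul, smul_eq_mul, Complex.conj_mul']
  have h2 : ‖x‖ ^ 2 = T := by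
    have h3 : (inner ℂ x x : ℂ) = (T : ℂ) := by
      rw [hx, hv.inner_sum, hT]
      push_cast
      refine Finset.sum_congr rfl fun i _ => ?_
      rw [Complex.conj_conj, Complex.mul_conj']
    rw [inner_self_eq_ofReal_norm_sq] at h3
    exact Complex.ofReal_injective h3
  have h3 : T ≤ ‖φ‖ * ‖x‖ := by
    have := φ.le_opNorm x
    rwa [h1, Complex.norm_real, Real.norm_of_nonneg hT0] at this
  rcases hT0.eq_or_lt with h0 | h0
  · rw [← h0]; positivity
  · have h4 : T ^ 2 ≤ ‖φ‖ ^ 2 * T := by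
      calc T ^ 2 ≤ (‖φ‖ * ‖x‖) ^ 2 := by gcongr
        _ = _ := by rw [mul_pow, h2]
    nlinarith

theorem Orthonormal.summable_norm_sq_apply (hv : Orthonormal ℂ v) (φ : StrongDual ℂ V) :
    Summable fun i => ‖φ (v i)‖ ^ 2 :=
  summable_of_sum_le (fun _ => sq_nonneg _) (hv.sum_norm_sq_apply_le φ)

/-- Cauchy–Schwarz on finite combinations bounds `‖φ x‖` by the `ℓ²` norm of the values times `‖x‖`,
and density extends this to all `x`. It is what makes the Bergman kernel the squared norm of an
evaluation functional, whatever the basis. -/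
theorem Orthonormal.tsum_norm_sq_apply (hv : Orthonormal ℂ v)
    (hd : Dense (Submodule.span ℂ (Set.range v) : Set V)) (φ : StrongDual ℂ V) :
    ∑' i, ‖φ (v i)‖ ^ 2 = ‖φ‖ ^ 2 := by
  have hsum := hv.summable_norm_sq_apply φ
  have h0 : 0 ≤ ∑' i, ‖φ (v i)‖ ^ 2 := tsum_nonneg fun _ => sq_nonneg _
  refine le_antisymm (hsum.tsum_le_of_sum_le (hv.sum_norm_sq_apply_le φ)) ?_
  suffices h : ‖φ‖ ≤ √(∑' i, ‖φ (v i)‖ ^ 2) by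
    calc ‖φ‖ ^ 2 ≤ √(∑' i, ‖φ (v i)‖ ^ 2) ^ 2 := by gcongr
      _ = _ := Real.sq_sqrt h0
  refine φ.opNorm_le_bound (Real.sqrt_nonneg _) fun x => ?_
  refine hd.induction ?_ (isClosed_le (by fun_prop) (by fun_prop)) x
  intro y hy
  obtain ⟨c, rfl⟩ := (Finsupp.mem_span_range_iff_exists_finsupp).1 hy
  rw [Finsupp.sum, map_sum]
  have hn : ‖∑ i ∈ c.support, c i • v i‖ = √(∑ i ∈ c.support, ‖c i‖ ^ 2) := by
    rw [eq_comm, Real.sqrt_eq_iff_eq_sq (Finset.sum_nonneg fun _ _ => sq_nonneg _) (norm_nonneg _)]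
    have h3 : (inner ℂ (∑ i ∈ c.support, c i • v i) (∑ i ∈ c.support, c i • v i) : ℂ) =
        ((∑ i ∈ c.support, ‖c i‖ ^ 2 : ℝ) : ℂ) := by
      rw [hv.inner_sum]
      push_cast
      exact Finset.sum_congr rfl fun i _ => Complex.conj_mul' _
    rw [inner_self_eq_ofReal_norm_sq] at h3
    exact Complex.ofReal_injective h3.symm
  rw [hn]
  calc ‖∑ i ∈ c.support, φ (c i • v i)‖ ≤ ∑ i ∈ c.support, ‖φ (v i)‖ * ‖c i‖ := by
        refine (norm_sum_le _ _).trans (le_of_eq (Finset.sum_congr rfl fun i _ => ?_))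
        rw [map_smul, norm_smul, mul_comm]
    _ ≤ √(∑ i ∈ c.support, ‖φ (v i)‖ ^ 2) * √(∑ i ∈ c.support, ‖c i‖ ^ 2) :=
        Real.sum_mul_le_sqrt_mul_sqrt _ _ _
    _ ≤ _ := by
        gcongr
        exact hsum.sum_le_tsum _ fun _ _ => sq_nonneg _

/-- The coordinates of a continuous functional with respect to an orthonormal family with dense
span, as a linear isometry into `ℓ²`. -/
noncomputable def Orthonormal.dualCoordinates (hv : Orthonormal ℂ v)
    (hd : Dense (Submodule.span ℂ (Set.range v) : Set V)) :
    StrongDual ℂ V →ₗᵢ[ℂ] lp (fun _ : ι => ℂ) 2 where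
  toFun φ := ⟨fun i => φ (v i), memℓp_gen (by simpa using hv.summable_norm_sq_apply φ)⟩
  map_add' φ ψ := rfl
  map_smul' c φ := rfl
  norm_map' φ := by
    have h := lp.norm_rpow_eq_tsum (p := 2) (by norm_num)
      (⟨fun i => φ (v i), memℓp_gen (by simpa using hv.summable_norm_sq_apply φ)⟩ :
        lp (fun _ : ι => ℂ) 2)
    simp only [ENNReal.toReal_ofNat, Real.rpow_ofNat] at h
    rw [hv.tsum_norm_sq_apply hd φ] at h
    exact (pow_left_inj₀ (norm_nonneg _) (norm_nonneg _) two_ne_zero).1 h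

end DualCoordinates

end OrthonormalBases

/-! ### The complex Hessian of `log ‖H‖²` and its Fubini–Study form. -/

section LeviForm

open Filter Topology

variable {n : ℕ} {W : Type*} [NormedAddCommGroup W] [InnerProductSpace ℂ W]

theorem wirtinger_eq {u : ComplexSpace n → ℂ} {L : ComplexSpace n →L[ℝ] ℂ} {z : ComplexSpace n}
    (h : HasFDerivAt u L z) (j : Fin n) :
    wirtinger j u z = (L (EuclideanSpace.single j 1) -
      Complex.I * L (Complex.I • EuclideanSpace.single j (1 : ℂ))) / 2 := by
  rw [wirtinger, h.fderiv]
  congr 4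
  ext k
  simp

theorem wirtingerBar_eq {u : ComplexSpace n → ℂ} {L : ComplexSpace n →L[ℝ] ℂ}
    {z : ComplexSpace n} (h : HasFDerivAt u L z) (j : Fin n) :
    wirtingerBar j u z = (L (EuclideanSpace.single j 1) +
      Complex.I * L (Complex.I • EuclideanSpace.single j (1 : ℂ))) / 2 := by
  rw [wirtingerBar, h.fderiv]
  congr 4
  ext k
  simp

theorem exists_hasFDerivAt_inner {A B : ComplexSpace n → W} {A' B' : ComplexSpace n →L[ℂ] W}
    {z : ComplexSpace n} (hA : HasFDerivAt A A' z) (hB : HasFDerivAt B B' z) :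
    ∃ L : ComplexSpace n →L[ℝ] ℂ, HasFDerivAt (fun w => inner ℂ (A w) (B w)) L z ∧
      ∀ x, L x = inner ℂ (A z) (B' x) + inner ℂ (A' x) (B z) := by
  let _ : NormedSpace ℝ W := NormedSpace.restrictScalars ℝ ℂ W
  exact ⟨_, (hA.restrictScalars ℝ).inner ℂ (hB.restrictScalars ℝ), fun x => by simp⟩

/-- The inner product is conjugate-linear in its first slot, so with `H` holomorphic `∂/∂z̄_j`
differentiates only that slot. -/
theorem wirtingerBar_log_norm_sq {H : ComplexSpace n → W} {H' : ComplexSpace n →L[ℂ] W}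
    {z : ComplexSpace n} (hH : HasFDerivAt H H' z) (h0 : H z ≠ 0) (j : Fin n) :
    wirtingerBar j (fun w => ((Real.log (‖H w‖ ^ 2) : ℝ) : ℂ)) z =
      (inner ℂ (H z) (H z))⁻¹ * inner ℂ (H' (EuclideanSpace.single j 1)) (H z) := by
  obtain ⟨L, hL, hLx⟩ := exists_hasFDerivAt_inner hH hH
  have hpos : 0 < ‖H z‖ ^ 2 := by have := norm_pos_iff.2 h0; positivity
  have hN : (inner ℂ (H z) (H z) : ℂ) = ((‖H z‖ ^ 2 : ℝ) : ℂ) :=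
    inner_self_eq_ofReal_norm_sq _
  have hslit : (inner ℂ (H z) (H z) : ℂ) ∈ Complex.slitPlane := by
    rw [hN]; exact Complex.ofReal_mem_slitPlane.2 hpos
  have heq : (fun w => ((Real.log (‖H w‖ ^ 2) : ℝ) : ℂ)) =
      fun w => Complex.log (inner ℂ (H w) (H w)) := by
    funext w
    rw [inner_self_eq_norm_sq_to_K, Complex.ofReal_log (sq_nonneg _)]
    norm_cast
  have hd := ((Complex.hasDerivAt_log hslit).hasFDerivAt.restrictScalars ℝ).comp z hL
  rw [heq, wirtingerBar_eq (u := fun w => Complex.log (inner ℂ (H w) (H w))) hd]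
  simp [hLx]
  have := Complex.I_sq
  ring_nf
  simp [this]
  ring

/-- Dually, `∂/∂z_i` differentiates only the second slot, so the derivative of `A` does not appear.
-/
theorem wirtinger_mul_inner {A H : ComplexSpace n → W} {A' H' : ComplexSpace n →L[ℂ] W}
    {z : ComplexSpace n} (hA : HasFDerivAt A A' z) (hH : HasFDerivAt H H' z) (h0 : H z ≠ 0)
    (i : Fin n) :
    wirtinger i (fun w => (inner ℂ (H w) (H w) : ℂ)⁻¹ * inner ℂ (A w) (H w)) z =
      (inner ℂ (H z) (H z))⁻¹ * inner ℂ (A z) (H' (EuclideanSpace.single i 1)) -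
      ((inner ℂ (H z) (H z)) ^ 2)⁻¹ * inner ℂ (H z) (H' (EuclideanSpace.single i 1)) *
        inner ℂ (A z) (H z) := by
  obtain ⟨L, hL, hLx⟩ := exists_hasFDerivAt_inner hH hH
  obtain ⟨M, hM, hMx⟩ := exists_hasFDerivAt_inner hA hH
  have hN : (inner ℂ (H z) (H z) : ℂ) ≠ 0 := inner_self_ne_zero.2 h0
  have hd := (((hasDerivAt_inv hN).hasFDerivAt.restrictScalars ℝ).comp z hL).mul hM
  rw [wirtinger_eq (u := fun w => (inner ℂ (H w) (H w) : ℂ)⁻¹ * inner ℂ (A w) (H w)) hd]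
  simp [hLx, hMx]
  have := Complex.I_sq
  ring_nf
  simp [this]
  ring

/-- The complex Hessian of `log ‖H‖²` for a holomorphic map `H` into a Hilbert space. -/
theorem sum_wirtinger_log_norm_sq [CompleteSpace W] {H : ComplexSpace n → W}
    {U : Set (ComplexSpace n)} (hU : IsOpen U) (hH : DifferentiableOn ℂ H U)
    (h0 : ∀ z ∈ U, H z ≠ 0) {K : ComplexSpace n → ℝ} (hK : ∀ z ∈ U, K z = ‖H z‖ ^ 2)
    {z : ComplexSpace n} (hz : z ∈ U) (a : ComplexSpace n) :
    (∑ i, ∑ j, wirtinger i (wirtingerBar j fun w => ((Real.log (K w) : ℝ) : ℂ)) z *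
      a i * (starRingEnd ℂ) (a j)).re =
    ‖fderiv ℂ H z a‖ ^ 2 / ‖H z‖ ^ 2 - ‖(inner ℂ (H z) (fderiv ℂ H z a) : ℂ)‖ ^ 2 / ‖H z‖ ^ 4 := by
  set D := fderiv ℂ H z with hD
  have hHd : ∀ w ∈ U, HasFDerivAt H (fderiv ℂ H w) w := fun w hw =>
    (hH.differentiableAt (hU.mem_nhds hw)).hasFDerivAt
  have hbar : ∀ j, ∀ w ∈ U, wirtingerBar j (fun w => ((Real.log (K w) : ℝ) : ℂ)) w =
      (inner ℂ (H w) (H w))⁻¹ * inner ℂ (fderiv ℂ H w (EuclideanSpace.single j 1)) (H w) := by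
    intro j w hw
    rw [← wirtingerBar_log_norm_sq (hHd w hw) (h0 w hw) j, wirtingerBar, wirtingerBar]
    have : (fun w => ((Real.log (K w) : ℝ) : ℂ)) =ᶠ[𝓝 w]
        fun w => ((Real.log (‖H w‖ ^ 2) : ℝ) : ℂ) := by
      filter_upwards [hU.mem_nhds hw] with y hy
      rw [hK y hy]
    rw [this.fderiv_eq]
  have hcoeff : ∀ i j, wirtinger i (wirtingerBar j fun w => ((Real.log (K w) : ℝ) : ℂ)) z =
      (inner ℂ (H z) (H z))⁻¹ * inner ℂ (D (EuclideanSpace.single j 1))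
        (D (EuclideanSpace.single i 1)) -
      ((inner ℂ (H z) (H z)) ^ 2)⁻¹ * inner ℂ (H z) (D (EuclideanSpace.single i 1)) *
        inner ℂ (D (EuclideanSpace.single j 1)) (H z) := by
    intro i j
    have hA := ((hH.fderiv_holomorphic hU).differentiableAt (hU.mem_nhds hz)).hasFDerivAt.clm_apply
      (hasFDerivAt_const (EuclideanSpace.single j (1 : ℂ) : ComplexSpace n) z)
    rw [← wirtinger_mul_inner hA (hHd z hz) (h0 z hz) i, wirtinger, wirtinger]
    have : (wirtingerBar j fun w => ((Real.log (K w) : ℝ) : ℂ)) =ᶠ[𝓝 z] fun w =>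
        (inner ℂ (H w) (H w))⁻¹ * inner ℂ (fderiv ℂ H w (EuclideanSpace.single j 1)) (H w) := by
      filter_upwards [hU.mem_nhds hz] with y hy using hbar j y hy
    rw [this.fderiv_eq]
  have ha : D a = ∑ i, a i • D (EuclideanSpace.single i 1) := by
    conv_lhs => rw [← (EuclideanSpace.basisFun (Fin n) ℂ).sum_repr a]
    simp [map_sum]
  have hN : (inner ℂ (H z) (H z) : ℂ) = ((‖H z‖ ^ 2 : ℝ) : ℂ) :=
    inner_self_eq_ofReal_norm_sq _
  have hsum : ∑ i, ∑ j, wirtinger i (wirtingerBar j fun w => ((Real.log (K w) : ℝ) : ℂ)) z *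
      a i * (starRingEnd ℂ) (a j) = (inner ℂ (H z) (H z))⁻¹ * inner ℂ (D a) (D a) -
      ((inner ℂ (H z) (H z)) ^ 2)⁻¹ * (inner ℂ (H z) (D a) * inner ℂ (D a) (H z)) := by
    rw [ha]
    simp_rw [sum_inner, inner_sum, inner_smul_left, inner_smul_right, Finset.sum_mul_sum,
      Finset.mul_sum, hcoeff]
    -- Expanding `⟨D a, D a⟩` puts the conjugated index outermost; only this double sum must be
    -- swapped.
    rw [Finset.sum_comm (f := fun x i => (inner ℂ (H z) (H z))⁻¹ * _), ← Finset.sum_sub_distrib]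
    refine Finset.sum_congr rfl fun i _ => ?_
    rw [← Finset.sum_sub_distrib]
    refine Finset.sum_congr rfl fun j _ => ?_
    ring
  have hconj : (inner ℂ (H z) (D a) * inner ℂ (D a) (H z) : ℂ) =
      ((‖(inner ℂ (H z) (D a) : ℂ)‖ ^ 2 : ℝ) : ℂ) := by
    rw [← inner_conj_symm (D a) (H z), Complex.mul_conj']
    norm_cast
  have hDa : (inner ℂ (D a) (D a) : ℂ) = ((‖D a‖ ^ 2 : ℝ) : ℂ) :=
    inner_self_eq_ofReal_norm_sq _
  rw [hsum, hconj, hDa, hN]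
  norm_cast
  field_simp

/-- Pythagoras: the subtracted vector is the orthogonal projection of `k` on the line of `h`. -/
theorem levi_quotient_eq {h k : W} (h0 : h ≠ 0) :
    ‖k‖ ^ 2 / ‖h‖ ^ 2 - ‖(inner ℂ h k : ℂ)‖ ^ 2 / ‖h‖ ^ 4 =
      ‖k - ((inner ℂ h k : ℂ) / (‖h‖ ^ 2 : ℝ)) • h‖ ^ 2 / ‖h‖ ^ 2 := by
  have hp : 0 < ‖h‖ := norm_pos_iff.2 h0
  have h1 : ‖k - ((inner ℂ h k : ℂ) / (‖h‖ ^ 2 : ℝ)) • h‖ ^ 2 =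
      ‖k‖ ^ 2 - ‖(inner ℂ h k : ℂ)‖ ^ 2 / ‖h‖ ^ 2 := by
    rw [@norm_sub_sq ℂ, inner_smul_right, norm_smul, mul_pow, norm_div, Complex.norm_real,
      Real.norm_of_nonneg (by positivity), ← inner_conj_symm k h, div_mul_eq_mul_div,
      Complex.mul_conj']
    have : (RCLike.re (((‖(inner ℂ h k : ℂ)‖ : ℂ) ^ 2) / ((‖h‖ ^ 2 : ℝ) : ℂ)) : ℝ) =
        ‖(inner ℂ h k : ℂ)‖ ^ 2 / ‖h‖ ^ 2 := by
      rw [RCLike.re_eq_complex_re]; norm_cast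
    rw [this]
    field_simp
    ring
  rw [h1]
  field_simp

/-- The Levi form of `log ‖H‖²` is at most the squared distance of `k` to any multiple of `h`. -/
theorem levi_quotient_le {h k : W} (h0 : h ≠ 0) (c : ℂ) :
    ‖k‖ ^ 2 / ‖h‖ ^ 2 - ‖(inner ℂ h k : ℂ)‖ ^ 2 / ‖h‖ ^ 4 ≤ ‖k - c • h‖ ^ 2 / ‖h‖ ^ 2 := by
  have hp : 0 < ‖h‖ := norm_pos_iff.2 h0
  rw [levi_quotient_eq h0]
  gcongr ?_ / _
  set d := (inner ℂ h k : ℂ) / (‖h‖ ^ 2 : ℝ) with hd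
  have hsplit : k - c • h = (k - d • h) + (d - c) • h := by rw [sub_smul]; abel
  have horth : (inner ℂ (k - d • h) ((d - c) • h) : ℂ) = 0 := by
    rw [inner_smul_right, inner_sub_left, inner_smul_left, inner_self_eq_norm_sq_to_K, hd, map_div₀,
      inner_conj_symm, Complex.conj_ofReal]
    have : (‖h‖ : ℂ) ≠ 0 := by exact_mod_cast hp.ne'
    push_cast
    field_simp
    simp
  have := norm_add_sq_eq_norm_sq_add_norm_sq_of_inner_eq_zero (𝕜 := ℂ) _ _ horth
  rw [hsplit, pow_two, pow_two, this]
  nlinarith [mul_self_nonneg ‖(d - c) • h‖]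

end LeviForm

/-! ### The evaluation functional: bounds from inner and outer balls. -/

section Evaluation

open Filter Topology Metric

/-- The norm of the constant section `dz₁ ∧ ⋯ ∧ dz_n` on a ball of radius `ρ` in `ℂⁿ`. -/
noncomputable def ballMass (n : ℕ) (ρ : ℝ) : ℝ :=
  √(2 ^ n * volume.real (ball (0 : ComplexSpace n) ρ))

variable {n : ℕ}

theorem ballMass_pos {ρ : ℝ} (hρ : 0 < ρ) : 0 < ballMass n ρ := by
  have : 0 < volume.real (ball (0 : ComplexSpace n) ρ) :=
    ENNReal.toReal_pos (measure_ball_pos _ _ hρ).ne' measure_ball_lt_top.ne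
  unfold ballMass
  positivity

theorem ballMass_sq (ρ : ℝ) :
    ballMass n ρ ^ 2 = 2 ^ n * volume.real (ball (0 : ComplexSpace n) ρ) :=
  Real.sq_sqrt (by positivity)

theorem ofReal_ballMass_sq (ρ : ℝ) : ENNReal.ofReal (ballMass n ρ ^ 2) =
    2 ^ n * volume (ball (0 : ComplexSpace n) ρ) := by
  rw [ballMass_sq, ofReal_two_pow_mul, measureReal_def, ENNReal.ofReal_toReal measure_ball_lt_top.ne]

variable {V : Type*} [NormedAddCommGroup V] [InnerProductSpace ℂ V]
  {X : Type*} [TopologicalSpace X] [ChartedSpace (ComplexSpace n) X]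
  [IsManifold 𝓘(ℂ, ComplexSpace n) ω X]
  {F : X → ComplexSpace n} {g : ComplexSpace n → X}
  {S : V →ₗ[ℂ] CanonicalSection n X}

/-- The value of a square-integrable holomorphic section at a point is controlled by its norm. -/
theorem IsBergmanModel.norm_coeffAlong_le (hS : IsBergmanModel S) (hF : IsGlobalChart F g)
    {w : ComplexSpace n} {ρ : ℝ} (hρ : 0 < ρ) (hball : ball w ρ ⊆ Set.range F) (x : V) :
    ‖(S x).coeffAlong g w‖ ≤ (ballMass n ρ)⁻¹ * ‖x‖ := by
  have hd := hF.differentiableOn_coeffAlong (hS.mem_bergmanSpace x).1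
  have h1 := volume_ball_mul_enorm_sq_le (hd.mono hball)
  have h2 : ENNReal.ofReal (ballMass n ρ ^ 2) * ‖(S x).coeffAlong g w‖ₑ ^ 2 ≤ ‖x‖ₑ ^ 2 := by
    calc _ = 2 ^ n * (volume (ball w ρ) * ‖(S x).coeffAlong g w‖ₑ ^ 2) := by
          rw [ofReal_ballMass_sq, Measure.addHaar_ball_center volume w, mul_assoc]
      _ ≤ 2 ^ n * ∫⁻ z in Set.range F, ‖(S x).coeffAlong g z‖ₑ ^ 2 := by
          gcongr
          exact h1.trans (lintegral_mono_set hball)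
      _ = _ := by rw [← lintegral_domainMeasure, ← hF.normSq_eq, hS.normSq_eq]
  rw [← ofReal_norm, ← ofReal_norm, ← ENNReal.ofReal_pow (norm_nonneg _),
    ← ENNReal.ofReal_pow (norm_nonneg _), ← ENNReal.ofReal_mul (sq_nonneg _),
    ENNReal.ofReal_le_ofReal_iff (sq_nonneg _), ← mul_pow] at h2
  have hm := ballMass_pos (n := n) hρ
  have h3 := (pow_le_pow_iff_left₀ (by positivity) (norm_nonneg _) two_ne_zero).1 h2
  rwa [inv_mul_eq_div, le_div_iff₀ hm, mul_comm]

/-- `ev w` is the evaluation, in a global chart, of square-integrable holomorphic sections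
at `w`. -/
def IsEvaluation (S : V →ₗ[ℂ] CanonicalSection n X) (F : X → ComplexSpace n)
    (g : ComplexSpace n → X) (ev : ComplexSpace n → StrongDual ℂ V) : Prop :=
  ∀ w ∈ Set.range F, ∀ x, ev w x = (S x).coeffAlong g w

/-- Any ball inside the open image makes point evaluation continuous; off the image the value is `0`
by convention. -/
theorem IsBergmanModel.exists_isEvaluation (hS : IsBergmanModel S) (hF : IsGlobalChart F g) :
    ∃ ev : ComplexSpace n → StrongDual ℂ V, IsEvaluation S F g ev := by
  have : ∀ w, ∃ φ : StrongDual ℂ V, w ∈ Set.range F → ∀ x, φ x = (S x).coeffAlong g w := by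
    intro w
    by_cases hw : w ∈ Set.range F
    · obtain ⟨ρ, hρ, hb⟩ := Metric.isOpen_iff.1 hF.isOpen_range w hw
      let φ : V →ₗ[ℂ] ℂ :=
        { toFun := fun x => (S x).coeffAlong g w
          map_add' := fun x y => by rw [map_add]; rfl
          map_smul' := fun c x => by rw [map_smul]; rfl }
      exact ⟨φ.mkContinuous _ (hS.norm_coeffAlong_le hF hρ hb), fun _ x => rfl⟩
    · exact ⟨0, fun h => absurd h hw⟩
  choose ev hev using this
  exact ⟨ev, hev⟩

namespace IsEvaluation

variable {ev : ComplexSpace n → StrongDual ℂ V}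

theorem norm_le (hev : IsEvaluation S F g ev) (hS : IsBergmanModel S) (hF : IsGlobalChart F g)
    {w : ComplexSpace n} {ρ : ℝ} (hρ : 0 < ρ) (hball : ball w ρ ⊆ Set.range F) :
    ‖ev w‖ ≤ (ballMass n ρ)⁻¹ := by
  have := ballMass_pos (n := n) hρ
  refine (ev w).opNorm_le_bound (by positivity) fun x => ?_
  rw [hev w (hball (mem_ball_self hρ))]
  exact hS.norm_coeffAlong_le hF hρ hball x

theorem norm_le_on_half_ball (hev : IsEvaluation S F g ev) (hS : IsBergmanModel S)
    (hF : IsGlobalChart F g) {w : ComplexSpace n} {ρ : ℝ} (hρ : 0 < ρ)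
    (hball : ball w ρ ⊆ Set.range F) :
    ∀ z ∈ ball w (ρ / 2), ‖ev z‖ ≤ (ballMass n (ρ / 2))⁻¹ := fun z hz =>
  hev.norm_le hS hF (by positivity)
    ((ball_subset_ball' (by rw [mem_ball] at hz; linarith)).trans hball)

theorem differentiableOn_apply (hev : IsEvaluation S F g ev) (hS : IsBergmanModel S)
    (hF : IsGlobalChart F g) (x : V) : DifferentiableOn ℂ (fun w => ev w x) (Set.range F) :=
  (hF.differentiableOn_coeffAlong (hS.mem_bergmanSpace x).1).congr fun w hw => hev w hw x

theorem differentiableOn (hev : IsEvaluation S F g ev) (hS : IsBergmanModel S)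
    (hF : IsGlobalChart F g) : DifferentiableOn ℂ ev (Set.range F) := by
  intro w hw
  obtain ⟨ρ, hρ, hb⟩ := Metric.isOpen_iff.1 hF.isOpen_range w hw
  exact (differentiableAt_clm_of_forall_apply (R := ρ / 2) (by positivity)
    (fun x => (hev.differentiableOn_apply hS hF x).mono
      ((ball_subset_ball (by linarith)).trans hb))
    (hev.norm_le_on_half_ball hS hF hρ hb)).differentiableWithinAt

/-- The radius is halved because points of the half ball still have a ball of radius `ρ / 2` in the
image, where `ev` is uniformly bounded and Cauchy's estimate applies. -/
theorem norm_fderiv_le (hev : IsEvaluation S F g ev) (hS : IsBergmanModel S)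
    (hF : IsGlobalChart F g) {w : ComplexSpace n} {ρ : ℝ} (hρ : 0 < ρ)
    (hball : ball w ρ ⊆ Set.range F) :
    ‖fderiv ℂ ev w‖ ≤ 2 * (ballMass n (ρ / 2))⁻¹ / (ρ / 2) :=
  norm_fderiv_le_of_norm_le_on_ball (by positivity)
    ((hev.differentiableOn hS hF).mono ((ball_subset_ball (by linarith)).trans hball))
    (hev.norm_le_on_half_ball hS hF hρ hball)

end IsEvaluation

/-- A bounded holomorphic function on the image of a bounded global chart is the coefficient of a
square-integrable section. -/
theorem IsBergmanModel.exists_coeffAlong_eq (hS : IsBergmanModel S) (hF : IsGlobalChart F g)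
    {R : ℝ} (hR : Set.range F ⊆ ball 0 R) {h : ComplexSpace n → ℂ} (hh : Differentiable ℂ h)
    {M : ℝ} (hM0 : 0 ≤ M) (hM : ∀ w ∈ Set.range F, ‖h w‖ ≤ M) :
    ∃ x : V, (∀ w ∈ Set.range F, (S x).coeffAlong g w = h w) ∧ ‖x‖ ≤ M * ballMass n R := by
  set σ : CanonicalSection n X := sectionOfCoeff F h with hσ
  have hc : ∀ w ∈ Set.range F, σ.coeffAlong g w = h w := fun w hw =>
    hF.coeffAlong_sectionOfCoeff h hw
  have hnorm : σ.normSq ≤ ENNReal.ofReal ((M * ballMass n R) ^ 2) := by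
    rw [hF.normSq_eq, lintegral_domainMeasure]
    calc _ ≤ 2 ^ n * ∫⁻ _ in Set.range F, ENNReal.ofReal (M ^ 2) := by
          gcongr 2 ^ n * ?_
          refine setLIntegral_mono' hF.isOpen_range.measurableSet fun w hw => ?_
          rw [hc w hw, ← ofReal_norm, ← ENNReal.ofReal_pow (norm_nonneg _)]
          exact ENNReal.ofReal_le_ofReal (pow_le_pow_left₀ (norm_nonneg _) (hM w hw) 2)
      _ ≤ 2 ^ n * (ENNReal.ofReal (M ^ 2) * volume (ball (0 : ComplexSpace n) R)) := by
          rw [setLIntegral_const]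
          gcongr
      _ = _ := by
          rw [mul_pow, ENNReal.ofReal_mul (sq_nonneg _), ofReal_ballMass_sq]
          ring
  have hmem : σ ∈ CanonicalSection.bergmanSpace n X :=
    ⟨hF.isHolomorphic_of_coeffAlong (hh.differentiableOn.congr hc),
      hnorm.trans_lt ENNReal.ofReal_lt_top⟩
  rw [← hS.range_eq] at hmem
  obtain ⟨x, hx⟩ := hmem
  refine ⟨x, by rwa [hx], ?_⟩
  rw [← hx, hS.normSq_eq, ← ofReal_norm, ← ENNReal.ofReal_pow (norm_nonneg _),
    ENNReal.ofReal_le_ofReal_iff (sq_nonneg _)] at hnorm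
  exact (pow_le_pow_iff_left₀ (norm_nonneg _) (mul_nonneg hM0 (Real.sqrt_nonneg _))
    two_ne_zero).1 hnorm

/-- The test section has coefficient `1`; its norm is at most `ballMass n R` because the image lies
in `B_R`. -/
theorem IsEvaluation.one_le_norm_mul {ev : ComplexSpace n → StrongDual ℂ V}
    (hev : IsEvaluation S F g ev) (hS : IsBergmanModel S) (hF : IsGlobalChart F g) {R : ℝ}
    (hR : Set.range F ⊆ ball 0 R) {w : ComplexSpace n} (hw : w ∈ Set.range F) :
    1 ≤ ‖ev w‖ * ballMass n R := by
  obtain ⟨x, hx, hxn⟩ := hS.exists_coeffAlong_eq hF hR (h := fun _ => 1)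
    (differentiable_const _) zero_le_one (fun w _ => by simp)
  rw [one_mul] at hxn
  have h1 : ev w x = 1 := by rw [hev w hw, hx w hw]
  calc (1 : ℝ) = ‖ev w x‖ := by rw [h1, norm_one]
    _ ≤ ‖ev w‖ * ‖x‖ := (ev w).le_opNorm x
    _ ≤ _ := by gcongr

/-- The derivative of the evaluation functional stays away from the multiples of the evaluation
functional itself. -/
theorem IsEvaluation.norm_le_norm_fderiv_sub_mul {ev : ComplexSpace n → StrongDual ℂ V}
    (hev : IsEvaluation S F g ev) (hS : IsBergmanModel S) (hF : IsGlobalChart F g) {R : ℝ}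
    (hR0 : 0 < R) (hR : Set.range F ⊆ ball 0 R) (h0 : (0 : ComplexSpace n) ∈ Set.range F)
    (b : ComplexSpace n) (c : ℂ) :
    ‖b‖ ≤ ‖fderiv ℂ ev 0 b - c • ev 0‖ * (R * ballMass n R) := by
  have hm := ballMass_pos (n := n) hR0
  rcases eq_or_ne b 0 with rfl | hb
  · rw [norm_zero]; positivity
  have hbp : 0 < ‖b‖ := norm_pos_iff.2 hb
  -- The coefficient `⟨b, ·⟩` vanishes at `0`, so this section does not see `c • ev 0`, while its
  -- derivative along `b` is `‖b‖ ^ 2`.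
  obtain ⟨x, hx, hxn⟩ := hS.exists_coeffAlong_eq hF hR (h := fun w => innerSL ℂ b w)
    (innerSL ℂ b).differentiable (M := ‖b‖ * R) (by positivity) (fun w hw => by
      refine ((innerSL ℂ b).le_opNorm w).trans ?_
      rw [innerSL_apply_norm]
      gcongr
      exact (mem_ball_zero_iff.1 (hR hw)).le)
  have h1 : ev 0 x = 0 := by rw [hev 0 h0, hx 0 h0, map_zero]
  have hd : DifferentiableAt ℂ ev 0 :=
    (hev.differentiableOn hS hF).differentiableAt (hF.isOpen_range.mem_nhds h0)
  have h2 : fderiv ℂ ev 0 b x = ((‖b‖ ^ 2 : ℝ) : ℂ) := by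
    have h3 : HasFDerivAt (fun w => ev w x)
        (((ContinuousLinearMap.apply ℂ ℂ x).comp (fderiv ℂ ev 0))) 0 :=
      (ContinuousLinearMap.apply ℂ ℂ x).hasFDerivAt.comp 0 hd.hasFDerivAt
    have h4 : HasFDerivAt (fun w => ev w x) (innerSL ℂ b) 0 := by
      refine (innerSL ℂ b).hasFDerivAt.congr_of_eventuallyEq ?_
      filter_upwards [hF.isOpen_range.mem_nhds h0] with w hw
      rw [hev w hw, hx w hw]
    have h5 := congrArg (fun T : ComplexSpace n →L[ℂ] ℂ => T b) (h3.unique h4)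
    simp only [ContinuousLinearMap.comp_apply, ContinuousLinearMap.apply_apply,
      innerSL_apply_apply] at h5
    rw [h5, inner_self_eq_ofReal_norm_sq]
  have h6 : ‖b‖ ^ 2 ≤ ‖fderiv ℂ ev 0 b - c • ev 0‖ * (‖b‖ * R * ballMass n R) := by
    calc ‖b‖ ^ 2 = ‖(fderiv ℂ ev 0 b - c • ev 0) x‖ := by
          rw [sub_apply, smul_apply, h1, smul_zero, sub_zero, h2,
            Complex.norm_real, Real.norm_of_nonneg (sq_nonneg _)]
      _ ≤ _ := (ContinuousLinearMap.le_opNorm _ _).trans (by gcongr)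
  nlinarith

end Evaluation

/-! ### Two-sided bounds for the Bergman metric. -/

section BergmanMetric

open Filter Topology Metric

variable {n : ℕ} {X : Type*} [TopologicalSpace X] [ChartedSpace (ComplexSpace n) X]
  [IsManifold 𝓘(ℂ, ComplexSpace n) ω X]
  {F : X → ComplexSpace n} {g : ComplexSpace n → X}

/-- The inverse chart factors as `g` after the transition map and has injective differential, so the
transition has one too. -/
theorem IsGlobalChart.det_globalTransition_ne_zero (hF : IsGlobalChart F g) {p : X}
    {z : ComplexSpace n} (hz : z ∈ (chartAt (ComplexSpace n) p).target) :
    (fderiv ℂ (globalTransition F p) z).det ≠ 0 := by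
  have hd := (((hF.mdifferentiableAt_symm (globalTransition_mem_range p z)).hasMFDerivAt).comp z
    (hF.differentiableAt_globalTransition hz).hasFDerivAt.hasMFDerivAt).congr_of_eventuallyEq
      (f₁ := (chartAt (ComplexSpace n) p).symm)
      (Eventually.of_forall fun y => (hF.comp_globalTransition p y).symm)
  have hsymm : Function.Injective (mfderiv 𝓘(ℂ, ComplexSpace n) 𝓘(ℂ, ComplexSpace n)
      (chartAt (ComplexSpace n) p).symm z) :=
    (mdifferentiable_chart (I := 𝓘(ℂ, ComplexSpace n)) p).symm.mfderiv_injective hz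
  rw [hd.mfderiv] at hsymm
  have hinj : Function.Injective (fderiv ℂ (globalTransition F p) z) :=
    Function.Injective.of_comp hsymm
  intro h0
  have hlt := LinearMap.bot_lt_ker_of_det_eq_zero h0
  rw [LinearMap.ker_eq_bot.2 hinj] at hlt
  exact lt_irrefl _ hlt

theorem mfderiv_eq_fderiv_globalTransition (hF : IsGlobalChart F g) (p : X)
    (v : TangentSpace 𝓘(ℂ, ComplexSpace n) p) :
    mfderiv 𝓘(ℂ, ComplexSpace n) 𝓘(ℂ, ComplexSpace n) F p v =
      fderiv ℂ (globalTransition F p) (chartAt (ComplexSpace n) p p)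
        (mfderiv 𝓘(ℂ, ComplexSpace n) 𝓘(ℂ, ComplexSpace n) (chartAt (ComplexSpace n) p) p v) := by
  set e := chartAt (ComplexSpace n) p with he
  have hs : p ∈ e.source := mem_chart_source _ p
  have h1 := (hF.differentiableAt_globalTransition (e.map_source hs)).hasFDerivAt.hasMFDerivAt.comp
    p (mdifferentiableAt_atlas (I := 𝓘(ℂ, ComplexSpace n))
      (chart_mem_atlas (ComplexSpace n) p) hs).hasMFDerivAt
  have h2 := h1.congr_of_eventuallyEq (f₁ := F) (by
    filter_upwards [e.open_source.mem_nhds hs] with x hx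
    exact congrArg F (e.left_inv hx).symm)
  exact congrArg (fun T : ComplexSpace n →L[ℂ] ComplexSpace n => T v) h2.mfderiv

variable {V : Type*} [NormedAddCommGroup V] [InnerProductSpace ℂ V]
  {S : V →ₗ[ℂ] CanonicalSection n X}

variable (F) in
/-- The evaluation of sections in the chart at `p`, in terms of the evaluation in a global
chart. -/
noncomputable def chartEvaluation (ev : ComplexSpace n → StrongDual ℂ V) (p : X)
    (z : ComplexSpace n) : StrongDual ℂ V :=
  (fderiv ℂ (globalTransition F p) z).det • ev (globalTransition F p z)

namespace IsEvaluation

variable {ev : ComplexSpace n → StrongDual ℂ V}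

theorem chartEvaluation_apply (hev : IsEvaluation S F g ev) (hF : IsGlobalChart F g) {p : X}
    {z : ComplexSpace n} (hz : z ∈ (chartAt (ComplexSpace n) p).target) (x : V) :
    chartEvaluation F ev p z x = (S x).coeff p z := by
  rw [hF.coeff_eq _ hz, ← hev _ (IsGlobalChart.globalTransition_mem_range p z), mul_comm]
  rfl

theorem chartEvaluation_ne_zero (hev : IsEvaluation S F g ev) (hS : IsBergmanModel S)
    (hF : IsGlobalChart F g) {R : ℝ} (hR : Set.range F ⊆ ball 0 R) {p : X} {z : ComplexSpace n}
    (hz : z ∈ (chartAt (ComplexSpace n) p).target) : chartEvaluation F ev p z ≠ 0 := by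
  refine smul_ne_zero (M := StrongDual ℂ V) (hF.det_globalTransition_ne_zero hz) fun h0 => ?_
  have := hev.one_le_norm_mul hS hF hR (IsGlobalChart.globalTransition_mem_range p z)
  rw [h0, norm_zero, zero_mul] at this
  exact absurd this (by norm_num)

theorem differentiableOn_chartEvaluation (hev : IsEvaluation S F g ev) (hS : IsBergmanModel S)
    (hF : IsGlobalChart F g) (p : X) :
    DifferentiableOn ℂ (chartEvaluation F ev p) (chartAt (ComplexSpace n) p).target := by
  have ht := hF.differentiableOn_globalTransition p
  exact (differentiableOn_det (ht.fderiv_holomorphic (chartAt (ComplexSpace n) p).open_target)).smul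
    ((hev.differentiableOn hS hF).comp ht fun z _ => IsGlobalChart.globalTransition_mem_range p z)

/-- Product rule: differentiating the determinant only adds a multiple of `ev`, which the Levi form
ignores, so its coefficient is left unspecified. -/
theorem fderiv_chartEvaluation (hev : IsEvaluation S F g ev) (hS : IsBergmanModel S)
    (hF : IsGlobalChart F g) {p : X} {z : ComplexSpace n}
    (hz : z ∈ (chartAt (ComplexSpace n) p).target) (a : ComplexSpace n) :
    ∃ c : ℂ, fderiv ℂ (chartEvaluation F ev p) z a = (fderiv ℂ (globalTransition F p) z).det •
      fderiv ℂ ev (globalTransition F p z) (fderiv ℂ (globalTransition F p) z a) +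
      c • ev (globalTransition F p z) := by
  have ht := hF.differentiableOn_globalTransition p
  have ho := (chartAt (ComplexSpace n) p).open_target
  have h1 := ((differentiableOn_det (ht.fderiv_holomorphic ho)).differentiableAt
    (ho.mem_nhds hz)).hasFDerivAt
  have h2 := ((hev.differentiableOn hS hF).differentiableAt
    (hF.isOpen_range.mem_nhds (IsGlobalChart.globalTransition_mem_range p z))).hasFDerivAt.comp z
    (hF.differentiableAt_globalTransition hz).hasFDerivAt
  have h3 := h1.smul h2
  refine ⟨fderiv ℂ (fun z => (fderiv ℂ (globalTransition F p) z).det) z a, ?_⟩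
  exact congrArg (fun T : ComplexSpace n →L[ℂ] StrongDual ℂ V => T a) h3.fderiv

end IsEvaluation

/-- Data computing the Bergman kernel of an orthonormal basis `s` as the squared norm of a
holomorphic map into a Hilbert space. -/
theorem IsBergmanModel.exists_bergmanKernel_eq (hS : IsBergmanModel S)
    {s : Set (CanonicalSection n X)} (hs : CanonicalSection.IsOrthonormalBasis s) :
    ∃ A : StrongDual ℂ V →ₗᵢ[ℂ] lp (fun _ : s => ℂ) 2,
      ∀ (F : X → ComplexSpace n) (g : ComplexSpace n → X) (ev : ComplexSpace n → StrongDual ℂ V),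
        IsGlobalChart F g → IsEvaluation S F g ev →
        ∀ p, ∀ z ∈ (chartAt (ComplexSpace n) p).target,
          (Summable fun σ : s => ‖(σ : CanonicalSection n X).coeff p z‖ ^ 2) ∧
          bergmanKernel s p z = ‖A (chartEvaluation F ev p z)‖ ^ 2 := by
  obtain ⟨v, hv, hvo, hvd⟩ := hS.exists_orthonormal_family hs
  refine ⟨hvo.dualCoordinates hvd, fun F g ev hF hev p z hz => ?_⟩
  have h1 : ∀ σ : s, ‖(σ : CanonicalSection n X).coeff p z‖ ^ 2 =
      ‖chartEvaluation F ev p z (v σ)‖ ^ 2 := fun σ => by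
    rw [hev.chartEvaluation_apply hF hz, hv]
  rw [bergmanKernel]
  simp_rw [h1]
  exact ⟨hvo.summable_norm_sq_apply _, by
    rw [LinearIsometry.norm_map, hvo.tsum_norm_sq_apply hvd]⟩

/-- Distance to the line of `φ` is unchanged by `c • φ`, and `J` cancels in the quotient: this is
the chart independence of the metric. `Q` carries only a norm, so inner products are taken after
`A`. -/
theorem levi_quotient_isometry_le {Q W : Type*} [NormedAddCommGroup Q] [NormedSpace ℂ Q]
    [NormedAddCommGroup W] [InnerProductSpace ℂ W] (A : Q →ₗᵢ[ℂ] W) {φ ψ : Q} {J c : ℂ}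
    (hJ : J ≠ 0) (hφ : φ ≠ 0) :
    ‖A (J • ψ + c • φ)‖ ^ 2 / ‖A (J • φ)‖ ^ 2 -
      ‖(inner ℂ (A (J • φ)) (A (J • ψ + c • φ)) : ℂ)‖ ^ 2 / ‖A (J • φ)‖ ^ 4 ≤
      (‖ψ‖ / ‖φ‖) ^ 2 := by
  have hne : A (J • φ) ≠ 0 := by
    rw [← norm_ne_zero_iff, A.norm_map, norm_ne_zero_iff]; exact smul_ne_zero hJ hφ
  refine (levi_quotient_le hne (c / J)).trans (le_of_eq ?_)
  have : J • ψ + c • φ - (c / J) • J • φ = J • ψ := by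
    rw [smul_smul, div_mul_cancel₀ _ hJ, add_sub_cancel_right]
  rw [← map_smul, ← map_sub, A.norm_map, A.norm_map, this, norm_smul, norm_smul, ← div_pow,
    mul_div_mul_left _ _ (norm_ne_zero_iff.2 hJ)]

theorem le_levi_quotient_isometry {Q W : Type*} [NormedAddCommGroup Q] [NormedSpace ℂ Q]
    [NormedAddCommGroup W] [InnerProductSpace ℂ W] (A : Q →ₗᵢ[ℂ] W) {φ ψ : Q} {J c : ℂ}
    (hJ : J ≠ 0) (hφ : φ ≠ 0) {δ : ℝ} (hδ0 : 0 ≤ δ) (hδ : ∀ c : ℂ, δ ≤ ‖ψ - c • φ‖) :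
    (δ / ‖φ‖) ^ 2 ≤ ‖A (J • ψ + c • φ)‖ ^ 2 / ‖A (J • φ)‖ ^ 2 -
      ‖(inner ℂ (A (J • φ)) (A (J • ψ + c • φ)) : ℂ)‖ ^ 2 / ‖A (J • φ)‖ ^ 4 := by
  have hne : A (J • φ) ≠ 0 := by
    rw [← norm_ne_zero_iff, A.norm_map, norm_ne_zero_iff]; exact smul_ne_zero hJ hφ
  rw [levi_quotient_eq hne]
  set d := (inner ℂ (A (J • φ)) (A (J • ψ + c • φ)) : ℂ) / (‖A (J • φ)‖ ^ 2 : ℝ)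
  have : J • ψ + c • φ - d • J • φ = J • (ψ - (d - c / J) • φ) := by
    rw [smul_sub, smul_smul J, mul_sub, mul_div_cancel₀ _ hJ, sub_smul, smul_smul, mul_comm d J]
    abel
  rw [← map_smul, ← map_sub, A.norm_map, A.norm_map, this, norm_smul, norm_smul, ← div_pow,
    mul_div_mul_left _ _ (norm_ne_zero_iff.2 hJ)]
  gcongr
  exact hδ _

/-- The Bergman metric at `p` is comparable with the Euclidean norm in a global chart centred at
`p` whose image lies between two balls. -/
theorem IsBergmanModel.bergmanMetric_bounds (hS : IsBergmanModel S)
    {s : Set (CanonicalSection n X)} (hs : CanonicalSection.IsOrthonormalBasis s)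
    (hF : IsGlobalChart F g) {r R : ℝ} (hr0 : 0 < r) (hR0 : 0 < R)
    (hr : ball 0 r ⊆ Set.range F) (hR : Set.range F ⊆ ball 0 R) {p : X} (hp : F p = 0)
    (v : TangentSpace 𝓘(ℂ, ComplexSpace n) p) (b : ComplexSpace n)
    (hb : b = mfderiv 𝓘(ℂ, ComplexSpace n) 𝓘(ℂ, ComplexSpace n) F p v) :
    ENNReal.ofReal (ballMass n r * (R * ballMass n R)⁻¹ * ‖b‖) ≤ bergmanMetric s p v ∧
    bergmanMetric s p v ≤
      ENNReal.ofReal (2 * (ballMass n (r / 2))⁻¹ / (r / 2) * ballMass n R * ‖b‖) := by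
  have hmr := ballMass_pos (n := n) hr0
  have hmr2 := ballMass_pos (n := n) (half_pos hr0)
  have hmR := ballMass_pos (n := n) hR0
  obtain ⟨A, hA⟩ := hS.exists_bergmanKernel_eq hs
  obtain ⟨ev, hev⟩ := hS.exists_isEvaluation hF
  set e := chartAt (ComplexSpace n) p with he
  set a : ComplexSpace n :=
    mfderiv 𝓘(ℂ, ComplexSpace n) 𝓘(ℂ, ComplexSpace n) (chartAt (ComplexSpace n) p) p v with ha
  have hz : e p ∈ e.target := e.map_source (mem_chart_source _ p)
  have hΦ : globalTransition F p (e p) = 0 := by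
    rw [← hp]; exact congrArg F (e.left_inv (mem_chart_source _ p))
  have h0 : (0 : ComplexSpace n) ∈ Set.range F := ⟨p, hp⟩
  have hHd : DifferentiableOn ℂ (fun z => A (chartEvaluation F ev p z)) e.target :=
    A.toContinuousLinearMap.differentiable.comp_differentiableOn
      (hev.differentiableOn_chartEvaluation hS hF p)
  have hfd : fderiv ℂ (fun z => A (chartEvaluation F ev p z)) (e p) a =
      A (fderiv ℂ (chartEvaluation F ev p) (e p) a) := by
    have h1 := A.toContinuousLinearMap.hasFDerivAt.comp (e p)
      (((hev.differentiableOn_chartEvaluation hS hF p).differentiableAt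
        (e.open_target.mem_nhds hz)).hasFDerivAt)
    exact congrArg (fun T : ComplexSpace n →L[ℂ] lp (fun _ : s => ℂ) 2 => T a) h1.fderiv
  have hlevi := sum_wirtinger_log_norm_sq e.open_target hHd (fun z hz => by
    rw [← norm_ne_zero_iff, A.norm_map, norm_ne_zero_iff]
    exact hev.chartEvaluation_ne_zero hS hF hR hz)
    (fun z hz => (hA F g ev hF hev p z hz).2) hz a
  obtain ⟨c, hc⟩ := hev.fderiv_chartEvaluation hS hF hz a
  have hba : fderiv ℂ (globalTransition F p) (e p) a = b := by
    rw [hb]; exact (mfderiv_eq_fderiv_globalTransition hF p v).symm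
  rw [hΦ, hba] at hc
  have hce : chartEvaluation F ev p (e p) =
      (fderiv ℂ (globalTransition F p) (e p)).det • ev 0 := by
    rw [chartEvaluation, hΦ]
  rw [hfd, hc, hce] at hlevi
  have hJ := hF.det_globalTransition_ne_zero hz
  have hev0 : ev 0 ≠ 0 := fun h => by
    have := hev.one_le_norm_mul hS hF hR h0
    rw [h, norm_zero, zero_mul] at this
    exact absurd this (by norm_num)
  have hevp : 0 < ‖ev 0‖ := norm_pos_iff.2 hev0
  have hmetric : bergmanMetric s p v = ENNReal.ofReal (√(∑ i, ∑ j,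
      wirtinger i (wirtingerBar j fun w => ((Real.log (bergmanKernel s p w) : ℝ) : ℂ)) (e p) *
        a i * (starRingEnd ℂ) (a j)).re) := rfl
  rw [hmetric, hlevi]
  constructor
  -- Lower bound: the distance to the line, from the test section `⟨b, ·⟩`, over `‖ev 0‖ ≤ 1 /
  -- ballMass n r`.
  · have hlow := le_levi_quotient_isometry A (ψ := fderiv ℂ ev 0 b) (c := c) hJ hev0
      (δ := (R * ballMass n R)⁻¹ * ‖b‖) (by positivity) (fun c' => by
        rw [inv_mul_le_iff₀ (by positivity), mul_comm]
        exact hev.norm_le_norm_fderiv_sub_mul hS hF hR0 hR h0 b c')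
    refine ENNReal.ofReal_le_ofReal (Real.le_sqrt_of_sq_le (le_trans ?_ hlow))
    gcongr
    rw [le_div_iff₀ hevp]
    have h1 := hev.norm_le hS hF hr0 hr
    calc _ ≤ ballMass n r * (R * ballMass n R)⁻¹ * ‖b‖ * (ballMass n r)⁻¹ := by gcongr
      _ = _ := by field_simp
  -- Upper bound: Cauchy's estimate for the derivative over `‖ev 0‖ ≥ 1 / ballMass n R`.
  · have hup := levi_quotient_isometry_le A (ψ := fderiv ℂ ev 0 b) (c := c) hJ hev0
    refine ENNReal.ofReal_le_ofReal (Real.sqrt_le_iff.2 ⟨by positivity, hup.trans ?_⟩)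
    gcongr
    rw [div_le_iff₀ hevp]
    have h1 := hev.one_le_norm_mul hS hF hR h0
    have h2 : ‖fderiv ℂ ev 0 b‖ ≤ 2 * (ballMass n (r / 2))⁻¹ / (r / 2) * ‖b‖ :=
      (fderiv ℂ ev 0).le_of_opNorm_le (hev.norm_fderiv_le hS hF hr0 hr) b
    calc ‖fderiv ℂ ev 0 b‖ ≤ 2 * (ballMass n (r / 2))⁻¹ / (r / 2) * ‖b‖ * 1 := by
          rw [mul_one]; exact h2
      _ ≤ 2 * (ballMass n (r / 2))⁻¹ / (r / 2) * ‖b‖ * (‖ev 0‖ * ballMass n R) := by gcongr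
      _ = _ := by ring

/-- The Bergman kernel of an orthonormal basis is a convergent sum, positive and smooth. -/
theorem IsBergmanModel.bergmanKernel_regular (hS : IsBergmanModel S)
    {s : Set (CanonicalSection n X)} (hs : CanonicalSection.IsOrthonormalBasis s)
    (hF : IsGlobalChart F g) {R : ℝ} (hR : Set.range F ⊆ ball 0 R) (p : X) :
    (∀ z ∈ (chartAt (ComplexSpace n) p).target,
      (Summable fun σ : s => ‖(σ : CanonicalSection n X).coeff p z‖ ^ 2) ∧
      0 < bergmanKernel s p z) ∧
    ContDiffOn ℝ ∞ (bergmanKernel s p) (chartAt (ComplexSpace n) p).target := by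
  obtain ⟨A, hA⟩ := hS.exists_bergmanKernel_eq hs
  obtain ⟨ev, hev⟩ := hS.exists_isEvaluation hF
  refine ⟨fun z hz => ⟨(hA F g ev hF hev p z hz).1, ?_⟩, ?_⟩
  · rw [(hA F g ev hF hev p z hz).2, A.norm_map]
    have := norm_pos_iff.2 (hev.chartEvaluation_ne_zero hS hF hR hz)
    positivity
  · have hHd : DifferentiableOn ℂ (fun z => A (chartEvaluation F ev p z))
        (chartAt (ComplexSpace n) p).target :=
      A.toContinuousLinearMap.differentiable.comp_differentiableOn
        (hev.differentiableOn_chartEvaluation hS hF p)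
    have h1 := (hHd.contDiffOn_of_isOpen (chartAt (ComplexSpace n) p).open_target).restrict_scalars ℝ
    exact (h1.norm_sq ℂ).congr fun z hz => (hA F g ev hF hev p z hz).2

end BergmanMetric

/-! ### Carathéodory and Kobayashi metrics; equivalence of metrics. -/

section InvariantMetrics

open Filter Topology Metric

/-- The infinitesimal **Schwarz–Pick lemma** at the centre of a disk. -/
theorem norm_deriv_le_of_mapsTo_unit_ball {φ : ℂ → ℂ} {R : ℝ} (hR : 0 < R)
    (hd : DifferentiableOn ℂ φ (ball 0 R)) (hm : ∀ z ∈ ball (0 : ℂ) R, φ z ∈ ball (0 : ℂ) 1) :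
    ‖deriv φ 0‖ ≤ (1 - ‖φ 0‖ ^ 2) / R := by
  set a := φ 0 with ha
  have h0 : (0 : ℂ) ∈ ball (0 : ℂ) R := mem_ball_self hR
  have ha1 : ‖a‖ < 1 := mem_ball_zero_iff.1 (hm 0 h0)
  have hden : ∀ w : ℂ, ‖w‖ < 1 → 1 - (starRingEnd ℂ) a * w ≠ 0 := fun w hw h => by
    have h1 : ‖(starRingEnd ℂ) a * w‖ < 1 := by
      rw [norm_mul, RCLike.norm_conj]
      nlinarith [norm_nonneg a, norm_nonneg w]
    rw [← sub_eq_zero.1 h, norm_one] at h1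
    exact lt_irrefl _ h1
  -- A disk automorphism moves `φ 0` to the origin, reducing the claim to the Schwarz lemma.
  set ψ : ℂ → ℂ := fun z => (φ z - a) / (1 - (starRingEnd ℂ) a * φ z) with hψ
  have hψd : DifferentiableOn ℂ ψ (ball 0 R) :=
    (hd.sub_const a).fun_div ((hd.const_mul _).const_sub 1) fun z hz =>
      hden _ (mem_ball_zero_iff.1 (hm z hz))
  have hψ0 : ψ 0 = 0 := by simp [hψ, ← ha]
  have hψm : Set.MapsTo ψ (ball 0 R) (closedBall (ψ 0) 1) := by
    intro z hz
    have hz1 : ‖φ z‖ < 1 := mem_ball_zero_iff.1 (hm z hz)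
    rw [hψ0, mem_closedBall_zero_iff, hψ, norm_div,
      div_le_one (norm_pos_iff.2 (hden _ hz1)), ← sq_le_sq₀ (norm_nonneg _) (norm_nonneg _),
      ← Complex.normSq_eq_norm_sq, ← Complex.normSq_eq_norm_sq]
    have h1 : Complex.normSq a < 1 := by
      rw [Complex.normSq_eq_norm_sq]; nlinarith [norm_nonneg a]
    have h2 : Complex.normSq (φ z) < 1 := by
      rw [Complex.normSq_eq_norm_sq]; nlinarith [norm_nonneg (φ z)]
    rw [Complex.normSq_apply] at h1 h2 ⊢
    rw [Complex.normSq_apply]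
    simp only [Complex.sub_re, Complex.sub_im, Complex.mul_re, Complex.mul_im, Complex.conj_re,
      Complex.conj_im, Complex.one_re, Complex.one_im]
    -- The identity used is `|1 - āw|² - |w - a|² = (1 - |a|²)(1 - |w|²)` with `w = φ z`.
    nlinarith [mul_nonneg (sub_nonneg.2 h1.le) (sub_nonneg.2 h2.le)]
  have hs := Complex.norm_deriv_le_div_of_mapsTo_ball hψd hψm hR
  have hφ0 : HasDerivAt φ (deriv φ 0) 0 :=
    (hd.differentiableAt (ball_mem_nhds 0 hR)).hasDerivAt
  have hq : (1 - (starRingEnd ℂ) a * a : ℂ) = ((1 - ‖a‖ ^ 2 : ℝ) : ℂ) := by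
    rw [Complex.conj_mul']; push_cast; rfl
  have hpos : 0 < 1 - ‖a‖ ^ 2 := by nlinarith [norm_nonneg a]
  have hψ' : deriv ψ 0 = deriv φ 0 / ((1 - ‖a‖ ^ 2 : ℝ) : ℂ) := by
    have h1 := (hφ0.sub_const a).fun_div ((hφ0.const_mul ((starRingEnd ℂ) a)).const_sub 1)
      (hden _ ha1)
    rw [h1.deriv, ← ha, hq, sub_self, zero_mul, sub_zero, pow_two]
    have : ((1 - ‖a‖ ^ 2 : ℝ) : ℂ) ≠ 0 := by exact_mod_cast hpos.ne'
    field_simp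
  rw [hψ', norm_div, Complex.norm_real, Real.norm_of_nonneg hpos.le, div_le_iff₀ hpos] at hs
  rwa [one_div_mul_eq_div] at hs

variable {n : ℕ} {X : Type*} [TopologicalSpace X] [ChartedSpace (ComplexSpace n) X]

/-- The Carathéodory metric is at most the Kobayashi metric. -/
theorem caratheodoryMetric_le_kobayashiMetric (p : X)
    (v : TangentSpace 𝓘(ℂ, ComplexSpace n) p) :
    caratheodoryMetric n X p v ≤ kobayashiMetric n X p v := by
  refine le_iInf₂ fun R hR => le_iInf₂ fun f hf => le_iInf fun htan =>
    iSup₂_le fun u hu => iSup_le fun hmaps => ENNReal.ofReal_le_ofReal ?_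
  have hfp : f 0 = p := congrArg (fun q : TangentBundle 𝓘(ℂ, ComplexSpace n) X => q.1) htan
  have hd : DifferentiableOn ℂ (u ∘ f) (ball 0 R) := by
    rw [← mdifferentiableOn_iff_differentiableOn]
    exact hu.comp_mdifferentiableOn hf
  have hf0 : MDifferentiableAt 𝓘(ℂ) 𝓘(ℂ, ComplexSpace n) f 0 :=
    (hf 0 (mem_ball_self hR)).mdifferentiableAt (ball_mem_nhds 0 hR)
  have hder : (mfderiv 𝓘(ℂ, ComplexSpace n) 𝓘(ℂ) u p v : ℂ) = deriv (u ∘ f) 0 := by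
    have h1 := (hu (f 0)).hasMFDerivAt.comp 0 hf0.hasMFDerivAt
    have h2 := congrArg (fun T : ℂ →L[ℂ] ℂ => T 1) h1.mfderiv
    -- `v` and `f' 0` live over the points `p` and `f 0`, so the equality in the tangent bundle is
    -- used whole.
    have h3 : (mfderiv 𝓘(ℂ, ComplexSpace n) 𝓘(ℂ) u p v : ℂ) =
        (mfderiv 𝓘(ℂ, ComplexSpace n) 𝓘(ℂ) u (f 0)
          (mfderiv 𝓘(ℂ) 𝓘(ℂ, ComplexSpace n) f 0 (1 : ℂ)) : ℂ) :=
      congrArg (fun q : TangentBundle 𝓘(ℂ, ComplexSpace n) X =>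
        (mfderiv 𝓘(ℂ, ComplexSpace n) 𝓘(ℂ) u q.1 q.2 : ℂ)) htan.symm
    rw [h3, ← fderiv_apply_one_eq_deriv, ← mfderiv_eq_fderiv]
    exact h2.symm
  have hs := norm_deriv_le_of_mapsTo_unit_ball hR hd fun z _ => hmaps (f z)
  have hp1 : ‖u p‖ < 1 := mem_ball_zero_iff.1 (hmaps p)
  have hpos : 0 < 1 - ‖u p‖ ^ 2 := by nlinarith [norm_nonneg (u p)]
  refine (le_of_eq (congrArg (poincareNorm (u p)) hder)).trans ?_
  rw [poincareNorm, div_le_iff₀ hpos]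
  rw [Function.comp_apply, hfp] at hs
  calc 2 * ‖deriv (u ∘ f) 0‖ ≤ 2 * ((1 - ‖u p‖ ^ 2) / R) := by gcongr
    _ = _ := by ring

variable {F : X → ComplexSpace n} {g : ComplexSpace n → X}

/-- The competitor is `⟨b, F ·⟩ / (‖b‖ R)`: Cauchy–Schwarz and the outer ball keep it in the unit
disk, and it vanishes at `p`. -/
theorem IsGlobalChart.le_caratheodoryMetric (hF : IsGlobalChart F g) {R : ℝ} (hR0 : 0 < R)
    (hR : Set.range F ⊆ ball 0 R) {p : X} (hp : F p = 0)
    (v : TangentSpace 𝓘(ℂ, ComplexSpace n) p) (b : ComplexSpace n)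
    (hb : b = mfderiv 𝓘(ℂ, ComplexSpace n) 𝓘(ℂ, ComplexSpace n) F p v) :
    ENNReal.ofReal (2 / R * ‖b‖) ≤ caratheodoryMetric n X p v := by
  rcases eq_or_ne b 0 with rfl | hb0
  · simp
  have hbp : 0 < ‖b‖ := norm_pos_iff.2 hb0
  set ℓ : ComplexSpace n →L[ℂ] ℂ := ((‖b‖ * R : ℝ) : ℂ)⁻¹ • innerSL ℂ b with hℓ
  have hu : HasMFDerivAt 𝓘(ℂ, ComplexSpace n) 𝓘(ℂ) (ℓ ∘ F) p
      (ContinuousLinearMap.comp ℓ (mfderiv 𝓘(ℂ, ComplexSpace n) 𝓘(ℂ, ComplexSpace n) F p)) :=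
    ℓ.hasMFDerivAt.comp p (hF.mdifferentiable p).hasMFDerivAt
  have hmd : MDifferentiable 𝓘(ℂ, ComplexSpace n) 𝓘(ℂ) (ℓ ∘ F) :=
    ℓ.mdifferentiable.comp hF.mdifferentiable
  have hnorm : ∀ w, ‖ℓ w‖ = (‖b‖ * R)⁻¹ * ‖(inner ℂ b w : ℂ)‖ := fun w => by
    rw [hℓ, smul_apply, innerSL_apply_apply, norm_smul, norm_inv,
      Complex.norm_real, Real.norm_of_nonneg (by positivity)]
  have hmaps : ∀ x, (ℓ ∘ F) x ∈ ball (0 : ℂ) 1 := fun x => by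
    rw [mem_ball_zero_iff, Function.comp_apply, hnorm, inv_mul_lt_iff₀ (by positivity), mul_one]
    refine (norm_inner_le_norm b (F x)).trans_lt ?_
    gcongr
    exact mem_ball_zero_iff.1 (hR ⟨x, rfl⟩)
  have hval : (mfderiv 𝓘(ℂ, ComplexSpace n) 𝓘(ℂ) (ℓ ∘ F) p v : ℂ) = ℓ b := by
    rw [hu.mfderiv, hb]; rfl
  have hpn : poincareNorm ((ℓ ∘ F) p) (ℓ b) = 2 / R * ‖b‖ := by
    rw [poincareNorm, hnorm, inner_self_eq_ofReal_norm_sq, Complex.norm_real,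
      Real.norm_of_nonneg (sq_nonneg _), Function.comp_apply, hp, map_zero, norm_zero]
    field_simp
    ring
  refine le_trans (le_of_eq ?_) (le_iSup₂_of_le (ℓ ∘ F) hmd (le_iSup_of_le hmaps le_rfl))
  rw [← hpn]
  exact congrArg (fun c => ENNReal.ofReal (poincareNorm ((ℓ ∘ F) p) c)) hval.symm

/-- The competitor is `ζ ↦ g (ζ • b)`, defined on the disk of radius `r / ‖b‖` thanks to the inner
ball. -/
theorem IsGlobalChart.kobayashiMetric_le (hF : IsGlobalChart F g) {r : ℝ} (hr0 : 0 < r)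
    (hr : ball 0 r ⊆ Set.range F) {p : X} (hp : F p = 0)
    (v : TangentSpace 𝓘(ℂ, ComplexSpace n) p) (b : ComplexSpace n)
    (hb : b = mfderiv 𝓘(ℂ, ComplexSpace n) 𝓘(ℂ, ComplexSpace n) F p v) :
    kobayashiMetric n X p v ≤ ENNReal.ofReal (2 / r * ‖b‖) := by
  have key : ∀ R : ℝ, 0 < R → R * ‖b‖ ≤ r →
      kobayashiMetric n X p v ≤ ENNReal.ofReal (2 / R) := by
    intro R hR hRb
    let L : ℂ →L[ℂ] ComplexSpace n := ContinuousLinearMap.toSpanSingleton ℂ b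
    have hL : ∀ ζ ∈ ball (0 : ℂ) R, L ζ ∈ Set.range F := fun ζ hζ => by
      refine hr (mem_ball_zero_iff.2 ?_)
      rw [ContinuousLinearMap.toSpanSingleton_apply, norm_smul]
      have h1 := mem_ball_zero_iff.1 hζ
      rcases (norm_nonneg b).eq_or_lt with h2 | h2
      · rw [← h2, mul_zero]; exact hr0
      · exact ((mul_lt_mul_iff_left₀ h2).2 h1).trans_le hRb
    have hmd : MDifferentiableOn 𝓘(ℂ) 𝓘(ℂ, ComplexSpace n) (g ∘ L) (ball 0 R) :=
      hF.mdifferentiableOn_symm.comp L.mdifferentiable.mdifferentiableOn hL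
    have hL0 : L 0 = F p := by rw [map_zero, hp]
    have hder := (hF.mdifferentiableAt_symm (hL 0 (mem_ball_self hR))).hasMFDerivAt.comp 0
      L.hasMFDerivAt
    have hv : ∀ w, w = F p →
        (mfderiv 𝓘(ℂ, ComplexSpace n) 𝓘(ℂ, ComplexSpace n) g w b : ComplexSpace n) = v := by
      rintro w rfl
      rw [hb]
      exact hF.mfderiv_symm_comp_mfderiv p v
    have hext : ∀ (x : X) (u w : ComplexSpace n), x = p → u = w →
        (⟨x, u⟩ : TangentBundle 𝓘(ℂ, ComplexSpace n) X) = ⟨p, w⟩ := by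
      rintro x u w rfl rfl; rfl
    have htan : tangentMap 𝓘(ℂ) 𝓘(ℂ, ComplexSpace n) (g ∘ L) ⟨0, (1 : ℂ)⟩ = ⟨p, v⟩ := by
      refine hext _ _ _ ?_ ?_
      · exact (congrArg g hL0).trans (hF.leftInverse p)
      · have h1 : mfderiv 𝓘(ℂ) 𝓘(ℂ, ComplexSpace n) (g ∘ L) 0 (1 : ℂ) =
            mfderiv 𝓘(ℂ, ComplexSpace n) 𝓘(ℂ, ComplexSpace n) g (L 0) (L 1) := by
          rw [hder.mfderiv]; rfl
        refine Eq.trans h1 ?_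
        have h2 : L 1 = b := by simp [L]
        rw [h2]
        exact hv _ hL0
    exact iInf₂_le_of_le R hR (iInf₂_le_of_le (g ∘ L) hmd (iInf_le_of_le htan le_rfl))
  rcases eq_or_ne b 0 with rfl | hb0
  -- For `b = 0` disks of every radius are admissible, so the infimum is the limit `0` of `2 / (k +
  -- 1)`.
  · rw [norm_zero, mul_zero, ENNReal.ofReal_zero]
    have hlim : Tendsto (fun k : ℕ => ENNReal.ofReal (2 / ((k : ℝ) + 1))) atTop (𝓝 0) := by
      have h1 := (tendsto_one_div_add_atTop_nhds_zero_nat (𝕜 := ℝ)).const_mul 2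
      rw [mul_zero] at h1
      rw [← ENNReal.ofReal_zero]
      refine (ENNReal.continuous_ofReal.tendsto 0).comp (h1.congr fun k => ?_)
      ring
    exact ge_of_tendsto' hlim fun k => key _ (by positivity) (by simp [hr0.le])
  · have hbp : 0 < ‖b‖ := norm_pos_iff.2 hb0
    refine (key (r / ‖b‖) (by positivity) (by rw [div_mul_cancel₀ _ hbp.ne'])).trans (le_of_eq ?_)
    congr 1
    field_simp

namespace FinslerMetric

theorem Equivalent.symm {N₁ N₂ : FinslerMetric n X} (h : Equivalent N₁ N₂) :
    Equivalent N₂ N₁ := by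
  obtain ⟨c, C, hc, hC, h⟩ := h
  refine ⟨C⁻¹, c⁻¹, inv_pos.2 hC, inv_pos.2 hc, fun p v => ⟨?_, ?_⟩⟩
  · rw [ENNReal.coe_inv hC.ne', ENNReal.inv_mul_le_iff (by positivity) ENNReal.coe_ne_top]
    exact (h p v).2
  · rw [ENNReal.coe_inv hc.ne', mul_comm, ← div_eq_mul_inv, ENNReal.le_div_iff_mul_le
      (Or.inl (by positivity)) (Or.inl ENNReal.coe_ne_top), mul_comm]
    exact (h p v).1

theorem Equivalent.trans {N₁ N₂ N₃ : FinslerMetric n X} (h : Equivalent N₁ N₂)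
    (h' : Equivalent N₂ N₃) : Equivalent N₁ N₃ := by
  obtain ⟨c, C, hc, hC, h⟩ := h
  obtain ⟨c', C', hc', hC', h'⟩ := h'
  refine ⟨c * c', C * C', mul_pos hc hc', mul_pos hC hC', fun p v => ⟨?_, ?_⟩⟩
  · rw [ENNReal.coe_mul, mul_assoc]
    exact (mul_le_mul_right (h' p v).1 _).trans (h p v).1
  · rw [ENNReal.coe_mul, mul_assoc]
    exact (h p v).2.trans (mul_le_mul_right (h' p v).2 _)

theorem equivalent_of_ofReal_bounds {N : FinslerMetric n X}
    {b : (p : X) → TangentSpace 𝓘(ℂ, ComplexSpace n) p → ℝ} {c C : ℝ} (hc : 0 < c) (hC : 0 < C)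
    (h : ∀ p v, ENNReal.ofReal (c * b p v) ≤ N p v ∧ N p v ≤ ENNReal.ofReal (C * b p v)) :
    Equivalent N fun p v => ENNReal.ofReal (b p v) := by
  refine ⟨c.toNNReal, C.toNNReal, Real.toNNReal_pos.2 hc, Real.toNNReal_pos.2 hC, fun p v => ?_⟩
  change ENNReal.ofReal c * _ ≤ _ ∧ _ ≤ ENNReal.ofReal C * _
  rw [← ENNReal.ofReal_mul hc.le, ← ENNReal.ofReal_mul hC.le]
  exact h p v

end FinslerMetric

end InvariantMetrics

/-! ### The comparison theorem. -/

/-- An empty manifold has no point from which to obtain a global chart; there every norm is `0`, so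
density is trivial. -/
theorem isOrthonormalBasis_empty {n : ℕ} {X : Type*} [TopologicalSpace X]
    [ChartedSpace (ComplexSpace n) X] [IsEmpty X] :
    CanonicalSection.IsOrthonormalBasis (∅ : Set (CanonicalSection n X)) where
  mem_bergmanSpace := Set.empty_subset _
  inner_self := fun _ h => absurd h (Set.notMem_empty _)
  inner_eq_zero := fun _ h => absurd h (Set.notMem_empty _)
  dense_span := fun τ _ ε hε => ⟨0, Submodule.zero_mem _, by
    rw [CanonicalSection.normSq, lintegralDensity, Set.eq_empty_of_isEmpty Set.univ, measure_empty]
    exact hε⟩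

theorem theorem5p3 (n : ℕ) (X : Type*) [TopologicalSpace X] [ChartedSpace (ComplexSpace n) X]
    [IsManifold 𝓘(ℂ, ComplexSpace n) ω X] (hX : IsHolomorphicHomogeneousRegular n X) :
    (∃ s : Set (CanonicalSection n X), CanonicalSection.IsOrthonormalBasis s) ∧
    ∀ s : Set (CanonicalSection n X), CanonicalSection.IsOrthonormalBasis s →
      -- the Bergman kernel is a convergent sum, positive and smooth, so that the metric is defined
      (∀ p : X, ∀ z ∈ (chartAt (ComplexSpace n) p).target,
        (Summable fun σ : s => ‖(σ : CanonicalSection n X).coeff p z‖ ^ 2) ∧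
        0 < bergmanKernel s p z) ∧
      (∀ p : X, ContDiffOn ℝ ∞ (bergmanKernel s p) (chartAt (ComplexSpace n) p).target) ∧
      -- the three metrics are mutually equivalent
      FinslerMetric.Equivalent (kobayashiMetric n X) (bergmanMetric s) ∧
      FinslerMetric.Equivalent (bergmanMetric s) (caratheodoryMetric n X) ∧
      FinslerMetric.Equivalent (kobayashiMetric n X) (caratheodoryMetric n X) := by
  obtain ⟨r, R, hr0, hrR, hX⟩ := hX
  have hR0 := hr0.trans hrR
  choose F hFd hFp hFo hFg hFr hFR using hX
  choose g hgF hgd using hFg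
  have hF : ∀ p, IsGlobalChart (F p) (g p) := fun p => ⟨hFd p, hFo p, hgF p, hgd p⟩
  rcases isEmpty_or_nonempty X with hX | ⟨⟨p₀⟩⟩
  · exact ⟨⟨∅, isOrthonormalBasis_empty⟩, fun s _ => ⟨isEmptyElim, isEmptyElim,
      ⟨1, 1, one_pos, one_pos, isEmptyElim⟩, ⟨1, 1, one_pos, one_pos, isEmptyElim⟩,
      ⟨1, 1, one_pos, one_pos, isEmptyElim⟩⟩⟩
  -- `IsBergmanModel` mentions no chart, so a model built from one base point serves for all the
  -- charts `F p`.
  obtain ⟨V, _, _, _, S, hS⟩ := (hF p₀).exists_isBergmanModel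
  obtain ⟨u, huo, hud⟩ := exists_orthonormal_dense_span (V := V)
  refine ⟨⟨S '' u, hS.isOrthonormalBasis_image huo hud⟩, fun s hs => ?_⟩
  let b : (p : X) → TangentSpace 𝓘(ℂ, ComplexSpace n) p → ComplexSpace n := fun p v =>
    mfderiv 𝓘(ℂ, ComplexSpace n) 𝓘(ℂ, ComplexSpace n) (F p) p v
  have hmr := ballMass_pos (n := n) hr0
  have hmr2 := ballMass_pos (n := n) (half_pos hr0)
  have hmR := ballMass_pos (n := n) hR0
  -- The reference length uses a different chart at each `p`, but the constants depend only on `n`,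
  -- `r`, `R`.
  have hB : FinslerMetric.Equivalent (bergmanMetric s) fun p v => ENNReal.ofReal ‖b p v‖ :=
    FinslerMetric.equivalent_of_ofReal_bounds (by positivity) (by positivity) fun p v =>
      hS.bergmanMetric_bounds hs (hF p) hr0 hR0 (hFr p) (hFR p) (hFp p) v (b p v) rfl
  have hlow : ∀ p v, ENNReal.ofReal (2 / R * ‖b p v‖) ≤ caratheodoryMetric n X p v := fun p v =>
    (hF p).le_caratheodoryMetric hR0 (hFR p) (hFp p) v (b p v) rfl
  have hup : ∀ p v, kobayashiMetric n X p v ≤ ENNReal.ofReal (2 / r * ‖b p v‖) := fun p v =>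
    (hF p).kobayashiMetric_le hr0 (hFr p) (hFp p) v (b p v) rfl
  have hCK := caratheodoryMetric_le_kobayashiMetric (n := n) (X := X)
  have hC : FinslerMetric.Equivalent (caratheodoryMetric n X)
      fun p v => ENNReal.ofReal ‖b p v‖ :=
    FinslerMetric.equivalent_of_ofReal_bounds (div_pos two_pos hR0) (div_pos two_pos hr0)
      fun p v => ⟨hlow p v, (hCK p v).trans (hup p v)⟩
  have hK : FinslerMetric.Equivalent (kobayashiMetric n X) fun p v => ENNReal.ofReal ‖b p v‖ :=
    FinslerMetric.equivalent_of_ofReal_bounds (div_pos two_pos hR0) (div_pos two_pos hr0)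
      fun p v => ⟨(hlow p v).trans (hCK p v), hup p v⟩
  exact ⟨fun p => (hS.bergmanKernel_regular hs (hF p₀) (hFR p₀) p).1,
    fun p => (hS.bergmanKernel_regular hs (hF p₀) (hFR p₀) p).2,
    hK.trans hB.symm, hB.trans hC.symm, hK.trans hC.symm⟩
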